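/- Let $\mathbb{K}$ be a field, $V$ a finite-dimensional $\mathbb{K}$-vector space, and $S=\operatorname{Sym}(V^*)$. A central arrangement $\mathcal{A}$ in $V$ is a finite (possibly empty) collection of linear hyperplanes of $V$; for $H\in\mathcal{A}$ let $\alpha_H\in V^*$ be a linear form with $\ker\alpha_H=H$. A multiplicity on $\mathcal{A}$ is a function $m:\mathcal{A}\to\mathbb{Z}_{>0}$, and it is called free if $$D(\mathcal{A},m)=\{\theta\in\operatorname{Der}_{\mathbb{K}}(S)\mid \theta(\alpha_H)\in S\cdot\alpha_H^{m(H)}\ \text{for all } H\in\mathcal{A}\}$$ is a free $S$-module. The arrangement $\mathcal{A}$ is called free if the constant multiplicity $1$ is free. Let $\mathcal{NFM}(\mathcal{A})$ be the set of all multiplicities on $\mathcal{A}$ that are not free. If $\mathcal{A}_i$ is a central arrangement in $V_i$ $(1\le i\le s)$, the product $\mathcal{A}_1\times\cdots\times\mathcal{A}_s$ is the arrangement in $V_1\oplus\cdots\oplus V_s$ that consists of the hyperplanes $V_1\oplus\cdots\oplus V_{i-1}\oplus H\oplus V_{i+1}\oplus\cdots\oplus V_s$ with $1\le i\le s$ and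 $H\in\mathcal{A}_i$. **Theorem.** For every central arrangement $\mathcal{A}$ in $V$ the following four conditions are equivalent: 1. $\mathcal{A}$ is totally free, i.e. every multiplicity on $\mathcal{A}$ is free ($\mathcal{NFM}(\mathcal{A})=\emptyset$); 2. $\mathcal{NFM}(\mathcal{A})$ is a finite set; 3. up to a linear isomorphism of the ambient spaces, $\mathcal{A}=\mathcal{A}_1\times\mathcal{A}_2\times\cdots\times\mathcal{A}_s$, where each $\mathcal{A}_i$ is a central arrangement in $\mathbb{K}^1$ or $\mathbb{K}^2$; 4. every subarrangement $\mathcal{B}\subseteq\mathcal{A}$ is free. -/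

import Mathlib

/-- A central arrangement in `V`: a finite collection of linear hyperplanes
(subspaces of codimension one). It may be empty. -/
@[ext]
structure CentralArrangement (K V : Type*) [Field K] [AddCommGroup V] [Module K V] where
  /-- the hyperplanes of the arrangement -/
  hyperplanes : Set (Submodule K V)
  finite : hyperplanes.Finite
  codim_one : ∀ H ∈ hyperplanes, Module.finrank K (V ⧸ H) = 1

namespace CentralArrangement

section

variable {K V : Type*} [Field K] [AddCommGroup V] [Module K V]

/-- A multiplicity on `A`: a function from the hyperplanes of `A` to the positive integers. -/
abbrev Multiplicity (A : CentralArrangement K V) : Type _ :=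
  A.hyperplanes → ℕ+

/-- The logarithmic derivation module `D(A, m)`, for `S = Sym(V*)`: the derivations `θ` of `S`
with `θ(α_H) ∈ S · α_H ^ m(H)` for all `H ∈ A`. The linear form `α_H` with kernel `H` is unique up
to a nonzero scalar, which does not affect the condition; so all such forms are admitted. -/
def logDerivations (A : CentralArrangement K V) (m : A.Multiplicity) :
    Submodule (SymmetricAlgebra K (Module.Dual K V))
      (Derivation K (SymmetricAlgebra K (Module.Dual K V))
        (SymmetricAlgebra K (Module.Dual K V))) where
  carrier := {θ | ∀ (H : A.hyperplanes) (α : Module.Dual K V), LinearMap.ker α = H.1 →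
    θ (SymmetricAlgebra.ι K (Module.Dual K V) α) ∈
      Ideal.span {SymmetricAlgebra.ι K (Module.Dual K V) α ^ (m H : ℕ)}}
  add_mem' := fun h₁ h₂ H α hα => by
    rw [Derivation.add_apply]
    exact Ideal.add_mem _ (h₁ H α hα) (h₂ H α hα)
  zero_mem' := fun H α _ => by
    rw [Derivation.zero_apply]
    exact Ideal.zero_mem _
  smul_mem' := fun c θ h H α hα => by
    rw [Derivation.smul_apply, smul_eq_mul]
    exact Ideal.mul_mem_left _ c (h H α hα)

/-- The multiplicity `m` is free (the multiarrangement `(A, m)` is free) if `D(A, m)` is a free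
`S`-module. -/
def IsFreeMultiplicity (A : CentralArrangement K V) (m : A.Multiplicity) : Prop :=
  Module.Free (SymmetricAlgebra K (Module.Dual K V)) (A.logDerivations m)

/-- The set of non-free multiplicities on `A`. -/
def NFM (A : CentralArrangement K V) : Set A.Multiplicity :=
  {m | ¬ A.IsFreeMultiplicity m}

/-- `A` is totally free if every multiplicity on `A` is free. -/
def IsTotallyFree (A : CentralArrangement K V) : Prop :=
  ∀ m : A.Multiplicity, A.IsFreeMultiplicity m

/-- A (simple) arrangement is free if the multiplicity that is constantly `1` is free. -/
def IsFree (A : CentralArrangement K V) : Prop :=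
  A.IsFreeMultiplicity fun _ => 1

/-- `B` is a subarrangement of `A`. -/
def IsSubarrangement (B A : CentralArrangement K V) : Prop :=
  B.hyperplanes ⊆ A.hyperplanes

theorem finrank_quotient_comap {W : Type*} [AddCommGroup W] [Module K W] (f : V →ₗ[K] W)
    (hf : Function.Surjective f) (H : Submodule K W) :
    Module.finrank K (V ⧸ H.comap f) = Module.finrank K (W ⧸ H) := by
  have hker : LinearMap.ker (H.mkQ.comp f) = H.comap f := by
    rw [LinearMap.ker_comp, Submodule.ker_mkQ]
  rw [← hker]
  exact ((H.mkQ.comp f).quotKerEquivOfSurjective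
    ((Submodule.mkQ_surjective H).comp hf)).finrank_eq

/-- The transport of an arrangement in `W` to `V` along a linear isomorphism `e : V ≃ W`. -/
def comapEquiv {W : Type*} [AddCommGroup W] [Module K W] (B : CentralArrangement K W)
    (e : V ≃ₗ[K] W) : CentralArrangement K V where
  hyperplanes := (fun H => H.comap (e : V →ₗ[K] W)) '' B.hyperplanes
  finite := B.finite.image _
  codim_one := by
    rintro _ ⟨H, hH, rfl⟩
    exact (finrank_quotient_comap (e : V →ₗ[K] W) e.surjective H).trans (B.codim_one H hH)

end

/-- The product `A₁ × ⋯ × A_s` in `V₁ ⊕ ⋯ ⊕ V_s`: its hyperplanes are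
`V₁ ⊕ ⋯ ⊕ H ⊕ ⋯ ⊕ V_s` with `H ∈ A_i` in the `i`-th place, that is, the preimages of the
hyperplanes of the `A_i` under the projections. -/
def prod {K : Type*} [Field K] {s : ℕ} {V : Fin s → Type*} [∀ i, AddCommGroup (V i)]
    [∀ i, Module K (V i)] (A : ∀ i, CentralArrangement K (V i)) :
    CentralArrangement K (∀ i, V i) where
  hyperplanes := ⋃ i, (fun H => H.comap (LinearMap.proj i : (∀ j, V j) →ₗ[K] V i)) ''
    (A i).hyperplanes
  finite := Set.finite_iUnion fun i => (A i).finite.image _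
  codim_one := by
    intro _ hX
    obtain ⟨i, H, hH, rfl⟩ := Set.mem_iUnion.1 hX
    exact (finrank_quotient_comap _ (LinearMap.proj_surjective i) H).trans ((A i).codim_one H hH)

/-- `A` has a decomposition `A = A₁ × ⋯ × A_s`, under a linear isomorphism of the ambient space
with `K^{d₁} ⊕ ⋯ ⊕ K^{d_s}`, where each `A_i` is an arrangement in `K^{d_i}` and
`d_i ∈ {1, 2}`. -/
def IsProductOfDimOneOrTwo {K V : Type*} [Field K] [AddCommGroup V] [Module K V]
    (A : CentralArrangement K V) : Prop :=
  ∃ (s : ℕ) (d : Fin s → ℕ) (B : ∀ i, CentralArrangement K (Fin (d i) → K))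
    (e : V ≃ₗ[K] (∀ i, Fin (d i) → K)),
    (∀ i, d i = 1 ∨ d i = 2) ∧ A = (prod B).comapEquiv e

end CentralArrangement

/-! All four conditions are governed by one obstruction, a long circuit (`IsLongCircuit`): a form
`h` of the arrangement with at least three nonzero coordinates in a basis of `V*`, where the basis
vectors that occur in `h` also define hyperplanes of the arrangement.

Suppose that there is none. Take a basis of `V*` that extends a maximal independent set of forms of
`A`, and link two basis vectors if some form involves both. Two links through a common vector yield
a long circuit after at most one basis exchange (`exists_isLongCircuit_of_linked`). So the classes
of linked vectors have at most two elements, every form lives on one class, and `A` is a product as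
in condition 3.

Freeness is tested by Saito's criterion: the module is free iff some square matrix of logarithmic
vectors has determinant `Q`, the defining polynomial, up to a scalar; its rows can then be taken
homogeneous (`free_logVectors_of_det`, `exists_homogeneous_det_associated`). In dimension two such a
matrix is built by raising one multiplicity at a time, using Bézout on a line
(`exists_det_eq_add_single`). Block diagonal matrices handle products, so 3 implies 1; it implies 4
because subarrangements of such products are again such products.

Conversely, a long circuit destroys freeness, by counting degrees in the Leibniz expansion of the
determinant. The circuit alone is a non-free subarrangement (`not_free_logVectors_of_circuit`). On
all of `A`, multiplicities `n`, `2n`, `3n`, ..., `3n` on the coordinate hyperplanes of the circuit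
and `1` elsewhere, with `n` large, would force the square of `h` to divide the determinant
(`not_free_logVectors_of_spread`); this gives infinitely many non-free multiplicities. -/

namespace CentralArrangement

open MvPolynomial

/-! ### Logarithmic vectors in coordinates and Saito's criterion. -/

section LinearForms

variable {K ι : Type*} [Field K] [Fintype ι]

/-- The linear form `∑ aᵢ Xᵢ` with coefficient vector `a`. -/
noncomputable def linForm (a : ι → K) : MvPolynomial ι K := ∑ i, C (a i) * X i

theorem linForm_isHomogeneous (a : ι → K) : (linForm a).IsHomogeneous 1 :=
  IsHomogeneous.sum _ _ _ fun i _ => isHomogeneous_C_mul_X (a i) i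

theorem coeff_single_linForm_mul (a : ι → K) (g : MvPolynomial ι K) (i : ι) :
    coeff (Finsupp.single i 1) (linForm a * g) = a i * coeff 0 g := by
  classical
  simp only [linForm, Finset.sum_mul, coeff_sum, mul_assoc, coeff_C_mul]
  rw [Finset.sum_eq_single i]
  · have := coeff_X_mul (0 : ι →₀ ℕ) i g
    rw [add_zero] at this
    rw [this]
  · intro j _ hj
    rw [coeff_X_mul', if_neg, mul_zero]
    simpa using hj
  · simp

theorem coeff_single_linForm (a : ι → K) (i : ι) :
    coeff (Finsupp.single i 1) (linForm a) = a i := by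
  simpa using coeff_single_linForm_mul a 1 i

theorem linForm_ne_zero {a : ι → K} (ha : a ≠ 0) : linForm a ≠ 0 := by
  intro h
  refine ha (funext fun i => ?_)
  rw [← coeff_single_linForm a i, h]
  simp

theorem linForm_prime {a : ι → K} (ha : a ≠ 0) : Prime (linForm a) := by
  apply Irreducible.prime
  apply irreducible_of_totalDegree_eq_one
    ((linForm_isHomogeneous a).totalDegree (linForm_ne_zero ha))
  intro x hx
  rw [isUnit_iff_ne_zero]
  rintro rfl
  refine ha (funext fun i => ?_)
  simpa [coeff_single_linForm] using hx (Finsupp.single i 1)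

theorem exists_smul_eq_of_linForm_dvd {a b : ι → K} (h : linForm a ∣ linForm b) :
    ∃ c : K, b = c • a := by
  obtain ⟨g, hg⟩ := h
  refine ⟨coeff 0 g, funext fun i => ?_⟩
  rw [← coeff_single_linForm b i, hg, coeff_single_linForm_mul, Pi.smul_apply, smul_eq_mul,
    mul_comm]

theorem linForm_single [DecidableEq ι] (i : ι) : linForm (Pi.single i (1 : K)) = X i := by
  rw [linForm, Finset.sum_eq_single i]
  · simp
  · intro j _ hj
    simp [hj]
  · simp

variable {J : Type*}

/-- The vectors `f` of polynomials for which `∑ᵢ aⱼᵢ fᵢ` is divisible by the `mⱼ`-th power of the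
`j`-th linear form: the logarithmic derivations in coordinates. -/
noncomputable def logVectors (a : J → ι → K) (m : J → ℕ) :
    Submodule (MvPolynomial ι K) (ι → MvPolynomial ι K) where
  carrier := {f | ∀ j, linForm (a j) ^ m j ∣ ∑ i, C (a j i) * f i}
  add_mem' := fun h₁ h₂ j => by
    simp only [Pi.add_apply, mul_add, Finset.sum_add_distrib]
    exact dvd_add (h₁ j) (h₂ j)
  zero_mem' := fun j => by simp
  smul_mem' := fun c f h j => by
    have : ∑ i, C (a j i) * (c • f) i = c * ∑ i, C (a j i) * f i := by
      rw [Finset.mul_sum]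
      exact Finset.sum_congr rfl fun i _ => by simp only [Pi.smul_apply, smul_eq_mul]; ring
    rw [this]
    exact (h j).mul_left c

/-- The defining polynomial of a multiarrangement. -/
noncomputable def definingPoly [Fintype J] (a : J → ι → K) (m : J → ℕ) : MvPolynomial ι K :=
  ∏ j, linForm (a j) ^ m j

/-- The coefficient vectors are nonzero and pairwise not proportional. -/
structure IsReducedFamily (a : J → ι → K) : Prop where
  ne_zero : ∀ j, a j ≠ 0
  not_smul : ∀ i j, i ≠ j → ∀ c : K, a i ≠ c • a j

theorem IsReducedFamily.not_dvd {a : J → ι → K} (ha : IsReducedFamily a) {i j : J} (h : i ≠ j) :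
    ¬ linForm (a i) ∣ linForm (a j) := fun hd =>
  let ⟨c, hc⟩ := exists_smul_eq_of_linForm_dvd hd
  ha.not_smul j i h.symm c hc

theorem IsReducedFamily.isRelPrime {a : J → ι → K} (ha : IsReducedFamily a) {i j : J}
    (h : i ≠ j) : IsRelPrime (linForm (a i)) (linForm (a j)) :=
  ((linForm_prime (ha.ne_zero i)).irreducible.isRelPrime_iff_not_dvd).2 (ha.not_dvd h)

/-- Applying `θ` to the coefficient vector of the form gives a multiple of its power; the adjugate
turns this into a statement about `θ.det` times a coefficient, and some coefficient is a unit. -/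
theorem linForm_pow_dvd_det [DecidableEq ι] {a : J → ι → K} (ha : IsReducedFamily a) {m : J → ℕ}
    {θ : Matrix ι ι (MvPolynomial ι K)} (hθ : ∀ i, θ i ∈ logVectors a m) (j : J) :
    linForm (a j) ^ m j ∣ θ.det := by
  obtain ⟨i, hi⟩ := Function.ne_iff.1 (ha.ne_zero j)
  choose g hg using fun k => hθ k j
  have h1 : θ.mulVec (fun i => C (a j i)) = linForm (a j) ^ m j • g := by
    ext1 k
    rw [Pi.smul_apply, smul_eq_mul, ← hg]
    exact Finset.sum_congr rfl fun i _ => mul_comm _ _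
  have h2 := congrArg (fun v => θ.adjugate.mulVec v i) h1
  simp only [Matrix.mulVec_mulVec, Matrix.adjugate_mul, Matrix.mulVec_smul, Matrix.smul_mulVec,
    Matrix.one_mulVec, Pi.smul_apply, smul_eq_mul] at h2
  have hu : IsUnit (C (σ := ι) (a j i)) := (isUnit_iff_ne_zero.2 hi).map C
  rw [← hu.dvd_mul_right, h2]
  exact dvd_mul_right _ _

variable [Fintype J]

theorem definingPoly_isHomogeneous (a : J → ι → K) (m : J → ℕ) :
    (definingPoly a m).IsHomogeneous (∑ j, m j) := by
  refine IsHomogeneous.prod _ _ _ fun j _ => ?_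
  simpa using (linForm_isHomogeneous (a j)).pow (m j)

theorem definingPoly_ne_zero {a : J → ι → K} (ha : IsReducedFamily a) (m : J → ℕ) :
    definingPoly a m ≠ 0 :=
  Finset.prod_ne_zero_iff.2 fun j _ => pow_ne_zero _ (linForm_ne_zero (ha.ne_zero j))

theorem linForm_not_dvd_prod_erase [DecidableEq J] {a : J → ι → K} (ha : IsReducedFamily a)
    (m : J → ℕ) (j : J) :
    ¬ linForm (a j) ∣ ∏ i ∈ Finset.univ.erase j, linForm (a i) ^ m i := by
  intro h
  have hp := linForm_prime (ha.ne_zero j)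
  obtain ⟨i, hi, hd⟩ := (hp.dvd_finsetProd_iff _).1 h
  exact ha.not_dvd (Finset.ne_of_mem_erase hi).symm (hp.dvd_of_dvd_pow hd)

theorem definingPoly_eq_mul_prod_erase [DecidableEq J] (a : J → ι → K) (m : J → ℕ) (j : J) :
    definingPoly a m =
      linForm (a j) ^ m j * ∏ i ∈ Finset.univ.erase j, linForm (a i) ^ m i :=
  (Finset.mul_prod_erase _ _ (Finset.mem_univ j)).symm

theorem linForm_pow_not_dvd_definingPoly {a : J → ι → K} (ha : IsReducedFamily a) (m : J → ℕ)
    (j : J) : ¬ linForm (a j) ^ (m j + 1) ∣ definingPoly a m := by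
  classical
  rw [definingPoly_eq_mul_prod_erase a m j, pow_succ,
    mul_dvd_mul_iff_left (pow_ne_zero _ (linForm_ne_zero (ha.ne_zero j)))]
  exact linForm_not_dvd_prod_erase ha m j

theorem smul_mem_logVectors_of_dvd {a : J → ι → K} {m : J → ℕ} {q : MvPolynomial ι K}
    (hq : definingPoly a m ∣ q) (f : ι → MvPolynomial ι K) : q • f ∈ logVectors a m := by
  intro j
  have : ∑ i, C (a j i) * (q • f) i = q * ∑ i, C (a j i) * f i := by
    rw [Finset.mul_sum]
    exact Finset.sum_congr rfl fun i _ => by simp only [Pi.smul_apply, smul_eq_mul]; ring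
  rw [this]
  exact ((Finset.dvd_prod_of_mem _ (Finset.mem_univ j)).trans hq).mul_right _

/-- The module lies between `Q • S^ι` and `S^ι`, so its rank is the number of variables. -/
theorem exists_basis_logVectors {a : J → ι → K} (ha : IsReducedFamily a) {m : J → ℕ}
    (h : Module.Free (MvPolynomial ι K) (logVectors a m)) :
    Nonempty (Module.Basis ι (MvPolynomial ι K) (logVectors a m)) := by
  have hle : Module.finrank (MvPolynomial ι K) (logVectors a m) ≤ Fintype.card ι := by
    simpa using LinearMap.finrank_le_finrank_of_injective
      (Submodule.injective_subtype (logVectors a m))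
  have hge : Fintype.card ι ≤ Module.finrank (MvPolynomial ι K) (logVectors a m) := by
    let φ : (ι → MvPolynomial ι K) →ₗ[MvPolynomial ι K] logVectors a m :=
      LinearMap.codRestrict _ (LinearMap.lsmul _ _ (definingPoly a m))
        fun f => smul_mem_logVectors_of_dvd dvd_rfl f
    have hφ : Function.Injective φ := by
      intro f g hfg
      exact smul_right_injective _ (definingPoly_ne_zero ha m) (congrArg Subtype.val hfg)
    simpa using LinearMap.finrank_le_finrank_of_injective hφ
  exact ⟨(Module.finBasisOfFinrankEq _ _ (le_antisymm hle hge)).reindex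
    (Fintype.equivFin ι).symm⟩

variable [DecidableEq ι]

theorem definingPoly_dvd_det {a : J → ι → K} (ha : IsReducedFamily a) {m : J → ℕ}
    {θ : Matrix ι ι (MvPolynomial ι K)} (hθ : ∀ i, θ i ∈ logVectors a m) :
    definingPoly a m ∣ θ.det :=
  Fintype.prod_dvd_of_isRelPrime (fun _ _ h => (ha.isRelPrime h).pow)
    fun j => linForm_pow_dvd_det ha hθ j

/-- Saito's criterion: a square matrix of logarithmic vectors whose determinant is the defining
polynomial up to a scalar shows that the module is free. -/
theorem free_logVectors_of_det {a : J → ι → K} (ha : IsReducedFamily a) {m : J → ℕ}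
    {θ : Matrix ι ι (MvPolynomial ι K)} (hθ : ∀ i, θ i ∈ logVectors a m)
    (hdet : Associated θ.det (definingPoly a m)) :
    Module.Free (MvPolynomial ι K) (logVectors a m) := by
  have hdet0 : θ.det ≠ 0 := hdet.ne_zero_iff.2 (definingPoly_ne_zero ha m)
  let v : ι → logVectors a m := fun i => ⟨θ i, hθ i⟩
  have hli : LinearIndependent (MvPolynomial ι K) v := by
    apply LinearIndependent.of_comp (logVectors a m).subtype
    exact Matrix.linearIndependent_rows_of_det_ne_zero hdet0
  refine Module.Free.of_basis (Module.Basis.mk hli ?_)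
  rintro ⟨f, hf⟩ -
  -- Cramer's rule expresses `f` through the rows of `θ` with these determinants divided by `θ.det`;
  -- each is divisible by `Q`, hence by `θ.det`.
  have hdvd : ∀ i, θ.det ∣ (θ.updateRow i f).det := by
    intro i
    refine hdet.dvd.trans (definingPoly_dvd_det ha fun k => ?_)
    by_cases h : k = i
    · subst h; simpa using hf
    · rw [Matrix.updateRow_ne h]; exact hθ k
  choose g hg using hdvd
  have key : ∑ i, g i • θ i = f := by
    have h1 : θ.transpose.mulVec (θ.transpose.cramer f) = θ.transpose.det • f :=
      Matrix.mulVec_cramer _ _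
    ext1 k
    have h2 := congrFun h1 k
    simp only [Matrix.mulVec, dotProduct, Matrix.cramer_transpose_apply, Matrix.transpose_apply,
      hg, Matrix.det_transpose, Pi.smul_apply, smul_eq_mul] at h2
    apply mul_left_cancel₀ hdet0
    rw [← h2, Finset.sum_apply, Finset.mul_sum]
    refine Finset.sum_congr rfl fun i _ => ?_
    simp only [Pi.smul_apply, smul_eq_mul]
    ring
  have : (⟨f, hf⟩ : logVectors a m) = ∑ i, g i • v i := by
    apply Subtype.ext
    simp [v, key]
  rw [this]
  exact Submodule.sum_mem _ fun i _ => Submodule.smul_mem _ _ (Submodule.subset_span ⟨i, rfl⟩)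

/-- The determinant of a basis of the module of logarithmic vectors is the defining polynomial, up
to a scalar. -/
theorem exists_det_associated {a : J → ι → K} (ha : IsReducedFamily a) {m : J → ℕ}
    (h : Module.Free (MvPolynomial ι K) (logVectors a m)) :
    ∃ θ : Matrix ι ι (MvPolynomial ι K),
      (∀ i, θ i ∈ logVectors a m) ∧ Associated θ.det (definingPoly a m) := by
  classical
  obtain ⟨b⟩ := exists_basis_logVectors ha h
  let θ : Matrix ι ι (MvPolynomial ι K) := fun i => (b i).1
  have hθ : ∀ i, θ i ∈ logVectors a m := fun i => (b i).2
  refine ⟨θ, hθ, ?_⟩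
  have hdvd : ∀ η : Matrix ι ι (MvPolynomial ι K), (∀ i, η i ∈ logVectors a m) →
      θ.det ∣ η.det := by
    intro η hη
    let c : Matrix ι ι (MvPolynomial ι K) := fun i k => b.repr ⟨η i, hη i⟩ k
    have : η = c * θ := by
      ext1 i k
      have h1 := congrArg (fun x : logVectors a m => x.1 k) (b.sum_repr ⟨η i, hη i⟩)
      simp only [Submodule.coe_sum, Submodule.coe_smul, Finset.sum_apply, Pi.smul_apply,
        smul_eq_mul] at h1
      exact h1.symm
    rw [this, Matrix.det_mul]
    exact dvd_mul_left _ _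
  have hpow : ∀ v : ι → MvPolynomial ι K, ∀ i₀ : ι, ∀ q : MvPolynomial ι K,
      (∀ k, q • ((1 : Matrix ι ι (MvPolynomial ι K)).updateCol i₀ v) k ∈ logVectors a m) →
      θ.det ∣ q ^ Fintype.card ι * v i₀ := by
    intro v i₀ q hq
    have := hdvd (q • (1 : Matrix ι ι (MvPolynomial ι K)).updateCol i₀ v) hq
    rwa [Matrix.det_smul, ← Matrix.cramer_apply, Matrix.cramer_one] at this
  have hone : θ.det ∣ definingPoly a m ^ Fintype.card ι := by
    have := hdvd (definingPoly a m • (1 : Matrix ι ι (MvPolynomial ι K)))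
      fun i => smul_mem_logVectors_of_dvd dvd_rfl _
    rwa [Matrix.det_smul, Matrix.det_one, mul_one] at this
  -- Away from the other hyperplanes the `j`-th one alone has an obvious basis. This bounds the
  -- order of `θ.det` along it by `m j`. With `hone`, which leaves only the linear forms as possible
  -- prime factors, the cofactor `u` below must be a unit.
  have hloc : ∀ j, θ.det ∣
      (∏ i ∈ Finset.univ.erase j, linForm (a i) ^ m i) ^ Fintype.card ι *
        linForm (a j) ^ m j := by
    intro j
    obtain ⟨i₀, hi₀⟩ := Function.ne_iff.1 (ha.ne_zero j)
    set q := ∏ i ∈ Finset.univ.erase j, linForm (a i) ^ m i with hq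
    -- Row `k ≠ i₀` becomes `e_k - (a_k / a_{i₀}) e_{i₀}`, which the `j`-th form kills; row `i₀`
    -- becomes the required power of the form times `e_{i₀}`.
    let v : ι → MvPolynomial ι K := fun k =>
      if k = i₀ then linForm (a j) ^ m j else C (-(a j k / a j i₀))
    have hv : v i₀ = linForm (a j) ^ m j := if_pos rfl
    rw [← hv]
    refine hpow v i₀ _ fun k j' => ?_
    have hsum : ∀ w : ι → MvPolynomial ι K,
        ∑ i, C (a j' i) * (q • w) i = q * ∑ i, C (a j' i) * w i := by
      intro w
      rw [Finset.mul_sum]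
      exact Finset.sum_congr rfl fun i _ => by simp only [Pi.smul_apply, smul_eq_mul]; ring
    rw [hsum]
    by_cases hj : j' = j
    · subst hj
      apply Dvd.dvd.mul_left
      by_cases hk : k = i₀
      · subst hk
        rw [Finset.sum_eq_single k]
        · simp [hv]
        · intro i _ hi
          simp [hi, Matrix.one_apply_ne hi.symm]
        · simp
      · have : ∑ i, C (a j' i) *
            ((1 : Matrix ι ι (MvPolynomial ι K)).updateCol i₀ v) k i = 0 := by
          rw [← Finset.sum_subset (Finset.subset_univ {k, i₀}), Finset.sum_pair hk]
          · simp only [Matrix.updateCol_apply, if_neg hk, if_true, Matrix.one_apply_eq, v,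
              mul_one, ← C_mul, ← C_add]
            rw [mul_neg, mul_div_cancel₀ _ hi₀, add_neg_cancel, C_0]
          · intro i _ hi
            simp only [Finset.mem_insert, Finset.mem_singleton, not_or] at hi
            simp [hi.2, Matrix.one_apply_ne (Ne.symm hi.1)]
        rw [this]
        exact dvd_zero _
    · exact (Finset.dvd_prod_of_mem _ (Finset.mem_erase.2 ⟨hj, Finset.mem_univ _⟩)).mul_right _
  obtain ⟨u, hu⟩ := definingPoly_dvd_det ha hθ
  have hQ := definingPoly_ne_zero ha m
  have hdet0 : θ.det ≠ 0 := fun h0 => pow_ne_zero _ hQ (zero_dvd_iff.1 (h0 ▸ hone))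
  have hu0 : u ≠ 0 := by rintro rfl; exact hdet0 (by simpa using hu)
  have hunit : IsUnit u := by
    by_contra hnu
    obtain ⟨π, hπ, hπu⟩ := WfDvdMonoid.exists_irreducible_factor hnu hu0
    have hπd : π ∣ definingPoly a m ^ Fintype.card ι :=
      (hπu.trans (hu ▸ dvd_mul_left _ _)).trans hone
    obtain ⟨j, -, hj⟩ := (hπ.prime.dvd_finsetProd_iff _).1 (hπ.prime.dvd_of_dvd_pow hπd)
    have hp := linForm_prime (ha.ne_zero j)
    have hju : linForm (a j) ∣ u :=
      ((hπ.prime.irreducible.associated_of_dvd hp.irreducible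
        (hπ.prime.dvd_of_dvd_pow hj)).symm.dvd).trans hπu
    have h1 : linForm (a j) ^ m j * linForm (a j) ∣
        linForm (a j) ^ m j *
          (∏ i ∈ Finset.univ.erase j, linForm (a i) ^ m i) ^ Fintype.card ι := by
      refine (mul_dvd_mul ?_ hju).trans (hu ▸ (hloc j).trans (mul_comm _ _).dvd)
      exact Finset.dvd_prod_of_mem _ (Finset.mem_univ j)
    rw [mul_dvd_mul_iff_left (pow_ne_zero _ hp.ne_zero)] at h1
    exact linForm_not_dvd_prod_erase ha m j (hp.dvd_of_dvd_pow h1)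
  rw [hu]
  exact associated_mul_unit_left _ _ hunit

end LinearForms

/-! ### Homogeneous bases. -/

section Homogeneous

variable {K ι J : Type*} [Field K]

theorem dvd_homogeneousComponent {p q : MvPolynomial ι K} {n : ℕ} (hp : p.IsHomogeneous n)
    (h : p ∣ q) (d : ℕ) : p ∣ homogeneousComponent d q := by
  let _ := MvPolynomial.gradedAlgebra (σ := ι) (R := K)
  rw [← Ideal.mem_span_singleton] at h ⊢
  refine homogeneousComponent_mem_of_mem (Ideal.homogeneous_span _ _ ?_) h d
  rintro _ rfl
  exact ⟨n, hp⟩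

variable [Fintype ι]

theorem homogeneousComponent_mem_logVectors {a : J → ι → K} {m : J → ℕ}
    {f : ι → MvPolynomial ι K} (hf : f ∈ logVectors a m) (d : ℕ) :
    (fun i => homogeneousComponent d (f i)) ∈ logVectors a m := by
  intro j
  have : ∑ i, C (a j i) * homogeneousComponent d (f i) =
      homogeneousComponent d (∑ i, C (a j i) * f i) := by
    simp [map_sum, homogeneousComponent_C_mul]
  rw [this]
  exact dvd_homogeneousComponent ((linForm_isHomogeneous (a j)).pow (m j)) (hf j) d

theorem isHomogeneous_det [DecidableEq ι] {θ : Matrix ι ι (MvPolynomial ι K)} {d : ι → ℕ}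
    (h : ∀ i k, (θ i k).IsHomogeneous (d i)) : θ.det.IsHomogeneous (∑ i, d i) := by
  rw [← Matrix.det_transpose, Matrix.det_apply]
  refine IsHomogeneous.sum _ _ _ fun σ _ => ?_
  have h1 : (∏ i, θ.transpose (σ i) i).IsHomogeneous (∑ i, d i) :=
    IsHomogeneous.prod _ _ _ fun i _ => h i (σ i)
  rcases Int.units_eq_one_or (Equiv.Perm.sign σ) with hs | hs
  · simpa [hs] using h1
  · simpa [hs] using h1.neg

/-- If the module of logarithmic vectors is free, then there is a matrix of logarithmic vectors
with homogeneous rows whose determinant is a nonzero scalar multiple of the defining polynomial. -/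
theorem exists_homogeneous_det_associated [DecidableEq ι] [Fintype J] {a : J → ι → K}
    (ha : IsReducedFamily a) {m : J → ℕ}
    (h : Module.Free (MvPolynomial ι K) (logVectors a m)) :
    ∃ (θ : Matrix ι ι (MvPolynomial ι K)) (d : ι → ℕ),
      (∀ i, θ i ∈ logVectors a m) ∧ (∀ i k, (θ i k).IsHomogeneous (d i)) ∧
      ∑ i, d i = ∑ j, m j ∧ Associated θ.det (definingPoly a m) := by
  classical
  obtain ⟨θ, hθ, hdet⟩ := exists_det_associated ha h
  obtain ⟨D, hD⟩ : ∃ D : ℕ, ∀ i k, (θ i k).totalDegree < D :=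
    ⟨(Finset.univ.sup fun i => Finset.univ.sup fun k => (θ i k).totalDegree) + 1, fun i k =>
      Nat.lt_succ_of_le ((Finset.le_sup (f := fun k => (θ i k).totalDegree)
        (Finset.mem_univ k)).trans (Finset.le_sup (f := fun i => Finset.univ.sup fun k =>
          (θ i k).totalDegree) (Finset.mem_univ i)))⟩
  let comp : ι → ℕ → ι → MvPolynomial ι K := fun i n k => homogeneousComponent n (θ i k)
  have hsum : θ = fun i => ∑ n ∈ Finset.range D, comp i n := by
    ext1 i k
    have h1 := sum_homogeneousComponent (θ i k)
    rw [Finset.sum_apply]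
    conv_lhs => rw [← h1]
    refine Finset.sum_subset (Finset.range_mono (hD i k)) fun n _ hn => ?_
    exact homogeneousComponent_eq_zero _ _ (by simpa [Nat.lt_succ_iff] using hn)
  -- By multilinearity in the rows. As `θ.det` is homogeneous, some choice `r` of row degrees with
  -- the right total has nonzero determinant; this is divisible by `Q` and of the same degree.
  have hexp : θ.det = ∑ r ∈ Fintype.piFinset fun _ : ι => Finset.range D,
      Matrix.det fun i => comp i (r i) := by
    conv_lhs => rw [hsum]
    exact (Matrix.detRowAlternating (R := MvPolynomial ι K)
      (n := ι)).toMultilinearMap.map_sum_finset comp fun _ => Finset.range D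
  have hhom : ∀ r : ι → ℕ,
      (Matrix.det fun i => comp i (r i)).IsHomogeneous (∑ i, r i) := fun r =>
    isHomogeneous_det fun i k => homogeneousComponent_isHomogeneous _ _
  have hθh : θ.det.IsHomogeneous (∑ j, m j) := by
    obtain ⟨u, hu⟩ := hdet.symm
    obtain ⟨c, -, hc⟩ := isUnit_iff_eq_C_of_isReduced.1 u.isUnit
    rw [← hu, hc]
    simpa using (definingPoly_isHomogeneous a m).mul (isHomogeneous_C ι c)
  have hdet0 : θ.det ≠ 0 := hdet.ne_zero_iff.2 (definingPoly_ne_zero ha m)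
  obtain ⟨r, hr, hr0⟩ : ∃ r : ι → ℕ, ∑ i, r i = ∑ j, m j ∧
      (Matrix.det fun i => comp i (r i)) ≠ 0 := by
    by_contra! hcon
    apply hdet0
    rw [← homogeneousComponent_eq_self hθh, hexp, map_sum]
    refine Finset.sum_eq_zero fun r _ => ?_
    rw [homogeneousComponent_of_mem (hhom r)]
    split_ifs with h1
    · exact hcon r h1.symm
    · rfl
  have hmem : ∀ i, comp i (r i) ∈ logVectors a m := fun i =>
    homogeneousComponent_mem_logVectors (hθ i) _
  refine ⟨fun i => comp i (r i), r, hmem,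
    fun i k => homogeneousComponent_isHomogeneous _ _, hr, ?_⟩
  obtain ⟨g, hg⟩ := definingPoly_dvd_det (θ := fun i => comp i (r i)) ha hmem
  have hg0 : g ≠ 0 := by rintro rfl; exact hr0 (by simpa using hg)
  have hQ := definingPoly_ne_zero ha m
  have hdeg : g.totalDegree = 0 := by
    have h1 := (hhom r).totalDegree hr0
    rw [hg, totalDegree_mul_of_isDomain hQ hg0, hr,
      (definingPoly_isHomogeneous a m).totalDegree hQ] at h1
    omega
  have hgu : IsUnit g := by
    rw [totalDegree_eq_zero_iff_eq_C.1 hdeg] at hg0 ⊢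
    exact (isUnit_iff_ne_zero.2 fun h0 => hg0 (by rw [h0, C_0])).map C
  rw [hg]
  exact associated_mul_unit_left _ _ hgu

end Homogeneous

/-! ### Long circuits obstruct freeness. -/

section NonFree

variable {K ι J : Type*} [Field K]

theorem eq_zero_of_dvd_of_isHomogeneous {p q : MvPolynomial ι K} {s d : ℕ}
    (hp : p.IsHomogeneous s) (hq : q.IsHomogeneous d) (hd : d < s) (h : p ∣ q) : q = 0 := by
  by_contra hq0
  have hp0 : p ≠ 0 := by rintro rfl; exact hq0 (zero_dvd_iff.1 h)
  have := totalDegree_le_of_dvd_of_isDomain h hq0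
  rw [hp.totalDegree hp0, hq.totalDegree hq0] at this
  omega

theorem isRelPrime_X_pow {i k : ι} (h : i ≠ k) (s t : ℕ) :
    IsRelPrime ((X i : MvPolynomial ι K) ^ s) (X k ^ t) := by
  refine IsRelPrime.pow ((X_prime.irreducible.isRelPrime_iff_not_dvd).2 fun hd => ?_)
  rw [X_dvd_X] at hd
  exact h (by simpa using hd)

variable [Fintype ι]

/-- The substitution that solves `linForm a = 0` for the variable `k`. -/
noncomputable def solveFor [DecidableEq ι] (a : ι → K) (k : ι) :
    MvPolynomial ι K →ₐ[K] MvPolynomial ι K :=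
  aeval (Function.update X k (X k - C (a k)⁻¹ * linForm a))

theorem linForm_dvd_sub_solveFor [DecidableEq ι] (a : ι → K) (k : ι) (f : MvPolynomial ι K) :
    linForm a ∣ f - solveFor a k f := by
  rw [← Ideal.mem_span_singleton, ← Ideal.Quotient.mk_eq_mk_iff_sub_mem]
  have : (Ideal.Quotient.mkₐ K (Ideal.span {linForm a})) =
      (Ideal.Quotient.mkₐ K (Ideal.span {linForm a})).comp (solveFor a k) := by
    refine MvPolynomial.algHom_ext fun i => ?_
    simp only [AlgHom.comp_apply, solveFor, aeval_X]
    by_cases hi : i = k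
    · subst hi
      rw [Function.update_self, eq_comm, Ideal.Quotient.mkₐ_eq_mk,
        Ideal.Quotient.mk_eq_mk_iff_sub_mem, Ideal.mem_span_singleton, sub_sub_cancel_left]
      exact (dvd_mul_left _ _).neg_right
    · rw [Function.update_of_ne hi]
  exact DFunLike.congr_fun this f

theorem solveFor_linForm [DecidableEq ι] {a : ι → K} {k : ι} (hk : a k ≠ 0) :
    solveFor a k (linForm a) = 0 := by
  conv_lhs => rw [linForm]
  rw [map_sum]
  have : ∀ i, solveFor a k (C (a i) * X i) = C (a i) * X i - if i = k then linForm a else 0 := by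
    intro i
    rw [map_mul, solveFor, aeval_X, ← algebraMap_eq, AlgHom.commutes]
    split_ifs with hi
    · subst hi
      rw [Function.update_self, mul_sub, algebraMap_eq, ← mul_assoc, ← C_mul, mul_inv_cancel₀ hk,
        C_1, one_mul]
    · rw [Function.update_of_ne hi, sub_zero]
  simp [this, linForm]

/-- On the hyperplane `linForm a = 0`, with `X i₂` eliminated, `X i₀` and `X i₁` remain coprime
variables. There `f₁ = -f₀` is divisible by `X i₀ ^ s * X i₁ ^ t`, whose degree exceeds `d`, so `f₁`
vanishes on the hyperplane. -/
theorem linForm_dvd_of_dvd_add {a : ι → K} {i₀ i₁ i₂ : ι} (h01 : i₀ ≠ i₁) (h02 : i₀ ≠ i₂)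
    (h12 : i₁ ≠ i₂) (ha : a i₂ ≠ 0) {f₀ f₁ : MvPolynomial ι K} {s t d : ℕ} (h₀ : X i₀ ^ s ∣ f₀)
    (h₁ : X i₁ ^ t ∣ f₁) (hf : f₁.IsHomogeneous d) (hd : d < s + t)
    (h : linForm a ∣ f₀ + f₁) : linForm a ∣ f₁ := by
  classical
  have hX : ∀ i, i ≠ i₂ → ∀ n, ∀ f, X i ^ n ∣ f → X i ^ n ∣ solveFor a i₂ f := by
    rintro i hi n _ ⟨g, rfl⟩
    refine ⟨solveFor a i₂ g, ?_⟩
    rw [map_mul, map_pow]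
    congr 2
    rw [solveFor, aeval_X, Function.update_of_ne hi]
  have hsum : solveFor a i₂ f₀ + solveFor a i₂ f₁ = 0 := by
    obtain ⟨g, hg⟩ := h
    rw [← map_add, hg, map_mul, solveFor_linForm ha, zero_mul]
  have h₀' : X i₀ ^ s ∣ solveFor a i₂ f₁ := by
    rw [← neg_eq_of_add_eq_zero_right hsum]
    exact (hX i₀ h02 s f₀ h₀).neg_right
  have hdvd := (isRelPrime_X_pow h01 s t).mul_dvd h₀' (hX i₁ h12 t f₁ h₁)
  have hhom : (solveFor a i₂ f₁).IsHomogeneous d := by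
    have := hf.aeval (Function.update X i₂ (X i₂ - C (a i₂)⁻¹ * linForm a)) (n := 1) fun i => by
      by_cases hi : i = i₂
      · subst hi
        rw [Function.update_self]
        refine (isHomogeneous_X _ _).sub ?_
        simpa using (isHomogeneous_C ι (a i)⁻¹).mul (linForm_isHomogeneous a)
      · rw [Function.update_of_ne hi]
        exact isHomogeneous_X _ _
    rwa [one_mul] at this
  have hzero : solveFor a i₂ f₁ = 0 := by
    refine eq_zero_of_dvd_of_isHomogeneous ?_ hhom hd hdvd
    simpa using ((isHomogeneous_X K i₀).pow s).mul ((isHomogeneous_X K i₁).pow t)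
  simpa [hzero] using linForm_dvd_sub_solveFor a i₂ f₁

theorem X_pow_dvd_of_mem_logVectors [DecidableEq ι] {a : J → ι → K} {m : J → ℕ} {j : J} {c : ι}
    (hj : a j = Pi.single c 1) {f : ι → MvPolynomial ι K} (hf : f ∈ logVectors a m) :
    X c ^ m j ∣ f c := by
  have h1 := hf j
  rw [hj, linForm_single, Finset.sum_eq_single c] at h1
  · simpa using h1
  · intro i _ hi
    simp [hi]
  · simp

variable [Fintype J]

/-- If the arrangement contains coordinate hyperplanes `c ∈ T` and a hyperplane `h` with support
`T` of size at least three, then it has non-free multiplicities, with very different values on two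
of the coordinate hyperplanes. -/
theorem not_free_logVectors_of_spread [DecidableEq ι] {a : J → ι → K} (ha : IsReducedFamily a)
    {m : J → ℕ} {h : J} {e : ι → J} (he : ∀ c, a h c ≠ 0 → a (e c) = Pi.single c 1)
    {i₀ i₁ i₂ : ι} (h01 : i₀ ≠ i₁) (h02 : i₀ ≠ i₂) (h12 : i₁ ≠ i₂)
    (ha₀ : a h i₀ ≠ 0) (ha₁ : a h i₁ ≠ 0) (ha₂ : a h i₂ ≠ 0) {t : ℕ}
    (hm₀ : m (e i₀) = t) (hm₁ : m (e i₁) = 2 * t)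
    (hm₂ : ∀ c, a h c ≠ 0 → c ≠ i₀ → c ≠ i₁ → m (e c) = 3 * t) (hmh : m h = 1)
    {T : Finset ι} (hT : ∀ c, c ∈ T ↔ a h c ≠ 0) (ht : ∑ j, m j < ∑ c ∈ T, m (e c) + t) :
    ¬ Module.Free (MvPolynomial ι K) (logVectors a m) := by
  classical
  intro hfree
  obtain ⟨θ, d, hθ, hhom, hsum, hdet⟩ := exists_homogeneous_det_associated ha hfree
  let N : ι → ℕ := fun c => if c ∈ T then m (e c) else 0
  have hNe : ∀ c, a h c ≠ 0 → N c = m (e c) := fun c hc => if_pos ((hT c).2 hc)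
  have hNT : ∑ c ∈ T, m (e c) = ∑ c, N c := by simp [N]
  rw [hNT] at ht
  have hXdvd : ∀ i c, X c ^ N c ∣ θ i c := by
    intro i c
    by_cases hc : a h c ≠ 0
    · rw [hNe c hc]
      exact X_pow_dvd_of_mem_logVectors (he c hc) (hθ i)
    · simp [N, hT, not_not.1 hc]
  have hzero : ∀ i c, d i < N c → θ i c = 0 := fun i c hlt =>
    eq_zero_of_dvd_of_isHomogeneous (by simpa using (isHomogeneous_X K c).pow (N c))
      (hhom i c) hlt (hXdvd i c)
  have hlin : ∀ i, linForm (a h) ∣ ∑ c, C (a h c) * θ i c := by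
    intro i
    have := hθ i h
    rwa [hmh, pow_one] at this
  have hunit : ∀ {c : K} {p q : MvPolynomial ι K}, c ≠ 0 → p ∣ C c * q → p ∣ q := by
    intro c p q hc hd
    exact (((isUnit_iff_ne_zero.2 hc).map C).dvd_mul_left).1 hd
  -- Each term of the Leibniz expansion is shown to vanish or to have two factors divisible by the
  -- form of `h`. This contradicts `m h = 1`.
  have hsq : linForm (a h) ^ 2 ∣ θ.det := by
    rw [Matrix.det_apply]
    refine Finset.dvd_sum fun σ _ => ?_
    rw [Units.smul_def, zsmul_eq_mul]
    apply Dvd.dvd.mul_left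
    by_cases hne : ∀ c, θ (σ c) c ≠ 0
    · have hge : ∀ c, N c ≤ d (σ c) := fun c => not_lt.1 fun hlt => hne c (hzero _ _ hlt)
      -- Every row degree is at least its `N c`, and the total excess is less than `t`, so no single
      -- row can exceed its bound by `t`.
      have hlt : ∀ c, d (σ c) < N c + t := by
        intro c
        have h1 : ∑ c, d (σ c) = ∑ j, m j := (Equiv.sum_comp σ d).trans hsum
        rw [← Finset.add_sum_erase _ _ (Finset.mem_univ c)] at h1
        rw [← Finset.add_sum_erase _ _ (Finset.mem_univ c)] at ht
        have h2 : ∑ x ∈ Finset.univ.erase c, N x ≤ ∑ x ∈ Finset.univ.erase c, d (σ x) :=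
          Finset.sum_le_sum fun x _ => hge x
        omega
      -- This row has degree below `2 * t`, so its entries in the other columns of `T` vanish.
      have hd₀ : linForm (a h) ∣ θ (σ i₀) i₀ := by
        have h1 := hlin (σ i₀)
        have hlt₀ := hlt i₀
        rw [hNe _ ha₀, hm₀] at hlt₀
        rw [Finset.sum_eq_single i₀] at h1
        · exact hunit ha₀ h1
        · intro c _ hc
          by_cases hac : a h c = 0
          · simp [hac]
          · rw [hzero, mul_zero]
            rw [hNe c hac]
            by_cases hc1 : c = i₁
            · subst hc1; omega
            · rw [hm₂ c hac hc hc1]; omega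
        · simp
      -- This row has degree below `3 * t = t + 2 * t`: only the columns `i₀` and `i₁` of `T`
      -- survive, and the degree is small enough for `linForm_dvd_of_dvd_add`.
      have hd₁ : linForm (a h) ∣ θ (σ i₁) i₁ := by
        have h1 := hlin (σ i₁)
        have hlt₁ := hlt i₁
        rw [hNe _ ha₁, hm₁] at hlt₁
        rw [← Finset.sum_subset (Finset.subset_univ {i₀, i₁}), Finset.sum_pair h01] at h1
        · have hx₀ := hXdvd (σ i₁) i₀
          have hx₁ := hXdvd (σ i₁) i₁
          rw [hNe _ ha₀, hm₀] at hx₀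
          rw [hNe _ ha₁, hm₁] at hx₁
          refine hunit ha₁ (linForm_dvd_of_dvd_add h01 h02 h12 ha₂ (hx₀.mul_left _)
            (hx₁.mul_left _) (d := d (σ i₁)) ?_ (by omega) h1)
          simpa using (isHomogeneous_C ι (a h i₁)).mul (hhom (σ i₁) i₁)
        · intro c _ hc
          simp only [Finset.mem_insert, Finset.mem_singleton, not_or] at hc
          by_cases hac : a h c = 0
          · simp [hac]
          · rw [hzero, mul_zero]
            rw [hNe c hac, hm₂ c hac hc.1 hc.2]
            omega
      rw [← Finset.mul_prod_erase _ _ (Finset.mem_univ i₀),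
        ← Finset.mul_prod_erase _ _ (Finset.mem_erase.2 ⟨h01.symm, Finset.mem_univ i₁⟩),
        ← mul_assoc, pow_two]
      exact (mul_dvd_mul hd₀ hd₁).mul_right _
    · push Not at hne
      obtain ⟨c, hc⟩ := hne
      exact (Finset.prod_eq_zero (f := fun c => θ (σ c) c) (Finset.mem_univ c) hc) ▸ dvd_zero _
  have := linForm_pow_not_dvd_definingPoly ha m h
  rw [hmh] at this
  exact this (hsq.trans hdet.dvd)

/-- A generic arrangement that consists of one more hyperplane than its rank is not free if the
rank is at least three. -/
theorem not_free_logVectors_of_circuit [DecidableEq ι] {a : J → ι → K} (ha : IsReducedFamily a)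
    {h : J} {e : ι → J} (he : ∀ c, a h c ≠ 0 → a (e c) = Pi.single c 1)
    {T : Finset ι} (hT : ∀ c, c ∈ T ↔ a h c ≠ 0) (hT3 : 3 ≤ T.card)
    (hJ : Fintype.card J ≤ T.card + 1) :
    ¬ Module.Free (MvPolynomial ι K) (logVectors a fun _ => 1) := by
  classical
  intro hfree
  obtain ⟨θ, d, hθ, hhom, hsum, hdet⟩ := exists_homogeneous_det_associated ha hfree
  have hdet0 : θ.det ≠ 0 := hdet.ne_zero_iff.2 (definingPoly_ne_zero ha _)
  have hfac : ∀ i c, ∃ p, θ i c = (if c ∈ T then X c else 1) * p := by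
    intro i c
    split_ifs with hc
    · have := X_pow_dvd_of_mem_logVectors (he c ((hT c).1 hc)) (hθ i)
      rwa [pow_one] at this
    · exact ⟨θ i c, (one_mul _).symm⟩
  choose F hF using hfac
  have hFX : ∀ i, ∀ c ∈ T, θ i c = X c * F i c := fun i c hc => by rw [hF, if_pos hc]
  have hF0 : Matrix.det F ≠ 0 := by
    intro h0
    apply hdet0
    have : θ = Matrix.of fun i c => (if c ∈ T then X c else 1) * F i c := by
      ext1 i c
      exact hF i c
    rw [this]
    exact (Matrix.det_mul_row _ (Matrix.of F)).trans
      (by rw [show (Matrix.of F).det = 0 from h0, mul_zero])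
  -- On the columns of `T`, a row of degree at most one is a scalar multiple of the Euler vector:
  -- compare the coefficients of each `X c` in the divisibility by the form of `h`.
  have hconst : ∀ i, d i ≤ 1 → ∃ u : K, ∀ c ∈ T, F i c = C u := by
    intro i hi
    obtain ⟨g, hg⟩ := hθ i h
    rw [pow_one] at hg
    refine ⟨coeff 0 g, fun c hc => ?_⟩
    have hcoeff : coeff 0 (F i c) = coeff 0 g := by
      have h1 := congrArg (coeff (Finsupp.single c 1)) hg
      rw [coeff_single_linForm_mul, coeff_sum, Finset.sum_eq_single c] at h1
      · rw [coeff_C_mul, hFX i c hc] at h1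
        have h2 := coeff_X_mul (0 : ι →₀ ℕ) c (F i c)
        rw [add_zero] at h2
        rw [h2] at h1
        exact mul_left_cancel₀ ((hT c).1 hc) h1
      · intro c' _ hcc
        by_cases hc' : c' ∈ T
        · rw [hFX i c' hc', coeff_C_mul, coeff_X_mul', if_neg, mul_zero]
          simpa using hcc
        · rw [hT, not_not] at hc'
          simp [hc']
      · simp
    rw [← hcoeff]
    by_cases hz : F i c = 0
    · simp [hz]
    · rw [← totalDegree_eq_zero_iff_eq_C]
      have h1 := hhom i c
      rw [hFX i c hc] at h1
      have h2 := h1.totalDegree (mul_ne_zero (X_ne_zero c) hz)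
      rw [totalDegree_mul_of_isDomain (X_ne_zero c) hz, totalDegree_X] at h2
      omega
  obtain ⟨c₀, hc₀⟩ : T.Nonempty := Finset.card_pos.1 (by omega)
  -- Column `c₀` is subtracted from the other columns of `T`. The determinant is unchanged, and rows
  -- of degree at most one get zeros in those columns.
  let F' : Matrix ι ι (MvPolynomial ι K) := fun i c =>
    F i c + (if c ∈ T.erase c₀ then -1 else 0) * F i c₀
  have hF' : F'.det ≠ 0 := by
    have : F'.transpose.det = (Matrix.transpose F).det :=
      Matrix.det_eq_of_forall_row_eq_smul_add_const
        (fun c => if c ∈ T.erase c₀ then -1 else 0) c₀ (by simp) fun i c => rfl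
    rw [← Matrix.det_transpose, this]
    exact fun h0 => hF0 ((Matrix.det_transpose (Matrix.of F)).symm.trans h0)
  obtain ⟨σ, hσ⟩ : ∃ σ : Equiv.Perm ι, ∀ c, F' (σ c) c ≠ 0 := by
    by_contra! hcon
    apply hF'
    rw [Matrix.det_apply]
    refine Finset.sum_eq_zero fun σ _ => ?_
    obtain ⟨c, hc⟩ := hcon σ
    rw [show ∏ c, F' (σ c) c = 0 from Finset.prod_eq_zero (Finset.mem_univ c) hc, smul_zero]
  have h2 : ∀ c ∈ T.erase c₀, 2 ≤ d (σ c) := by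
    intro c hc
    by_contra! hlt
    obtain ⟨u, hu⟩ := hconst (σ c) (by omega)
    apply hσ c
    simp only [F', if_pos hc]
    rw [hu c (Finset.mem_of_mem_erase hc), hu c₀ hc₀]
    ring
  have h1 : 1 ≤ d (σ c₀) := by
    by_contra! hlt
    apply hσ c₀
    have h3 : θ (σ c₀) c₀ = 0 :=
      eq_zero_of_dvd_of_isHomogeneous (isHomogeneous_X K c₀) (hhom _ _) hlt ⟨_, hFX _ _ hc₀⟩
    rw [hFX _ _ hc₀] at h3
    simpa [F'] using (mul_eq_zero.1 h3).resolve_left (X_ne_zero c₀)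
  have hle : ∑ c ∈ T, d (σ c) ≤ ∑ c, d (σ c) :=
    Finset.sum_le_sum_of_subset (Finset.subset_univ T)
  -- The degrees sum to at least `2 * (T.card - 1) + 1` but to at most `T.card + 1`, which is
  -- impossible for `3 ≤ T.card`.
  rw [Equiv.sum_comp σ d, hsum, ← Finset.add_sum_erase _ _ hc₀] at hle
  have h4 := Finset.card_nsmul_le_sum (T.erase c₀) (fun c => d (σ c)) 2 h2
  rw [Finset.card_erase_of_mem hc₀, smul_eq_mul] at h4
  simp only [Finset.sum_const, Finset.card_univ, smul_eq_mul, mul_one] at hle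
  omega

end NonFree

/-! ### Passage from derivations of the symmetric algebra to coordinates. -/

section Coordinates

variable {K V ι : Type*} [Field K] [AddCommGroup V] [Module K V]

theorem exists_ker_eq (A : CentralArrangement K V) {H : Submodule K V} (hH : H ∈ A.hyperplanes) :
    ∃ α : Module.Dual K V, LinearMap.ker α = H := by
  have h1 := A.codim_one H hH
  have : FiniteDimensional K (V ⧸ H) := Module.finite_of_finrank_eq_succ h1
  let e : (V ⧸ H) ≃ₗ[K] K := LinearEquiv.ofFinrankEq _ _ (by simpa using h1)
  refine ⟨e.toLinearMap.comp H.mkQ, ?_⟩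
  rw [LinearEquiv.ker_comp, Submodule.ker_mkQ]

theorem ne_zero_of_ker_mem {A : CentralArrangement K V} {α : Module.Dual K V}
    (h : LinearMap.ker α ∈ A.hyperplanes) : α ≠ 0 := by
  rintro rfl
  have h1 := A.codim_one _ h
  rw [LinearMap.ker_zero, Module.finrank_zero_of_subsingleton] at h1
  exact zero_ne_one h1

theorem exists_eq_smul_of_ker_eq {α β : Module.Dual K V}
    (h : LinearMap.ker α = LinearMap.ker β) : ∃ c : K, β = c • α := by
  have := mem_span_of_iInf_ker_le_ker (L := fun _ : Unit => α) (K := β) (by simp [h])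
  simpa [Submodule.mem_span_singleton, eq_comm] using this

theorem ker_eq_ker_of_eq_smul {α β : Module.Dual K V} {c : K} (hc : c ≠ 0) (h : β = c • α) :
    LinearMap.ker β = LinearMap.ker α := by
  rw [h, LinearMap.ker_smul _ _ hc]

variable (b : Module.Basis ι K (Module.Dual K V))

theorem isReducedFamily_repr {A : CentralArrangement K V}
    {α : A.hyperplanes → Module.Dual K V} (hα : ∀ H, LinearMap.ker (α H) = H.1) :
    IsReducedFamily fun (H : A.hyperplanes) i => b.repr (α H) i := by
  have h0 : ∀ H, α H ≠ 0 := fun H => ne_zero_of_ker_mem (A := A) ((hα H).symm ▸ H.2)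
  constructor
  · intro H h
    exact h0 H (b.repr.map_eq_zero_iff.1 (DFunLike.coe_injective h))
  · intro H H' hne c h
    have h1 : α H = c • α H' := by
      apply b.repr.injective
      rw [map_smul]
      exact DFunLike.coe_injective h
    have hc : c ≠ 0 := by
      rintro rfl
      exact h0 H (by simpa using h1)
    exact hne (Subtype.ext (by rw [← hα H, ← hα H', ker_eq_ker_of_eq_smul hc h1]))

/-- The derivation with prescribed values on a basis of the linear forms. -/
theorem exists_derivation (f : ι → MvPolynomial ι K) :
    ∃ θ : Derivation K (SymmetricAlgebra K (Module.Dual K V))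
      (SymmetricAlgebra K (Module.Dual K V)),
      ∀ i, SymmetricAlgebra.equivMvPolynomial b (θ (SymmetricAlgebra.ι K _ (b i))) = f i := by
  let e := SymmetricAlgebra.equivMvPolynomial b
  let D := mkDerivation K f
  refine ⟨Derivation.mk' (e.symm.toLinearMap ∘ₗ D.toLinearMap ∘ₗ e.toLinearMap) fun x y => ?_,
    fun i => ?_⟩
  · simp [Derivation.leibniz]
  · change e (e.symm (D (e (SymmetricAlgebra.ι K _ (b i))))) = f i
    rw [AlgEquiv.apply_symm_apply, SymmetricAlgebra.equivMvPolynomial_ι_apply, mkDerivation_X]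

variable [Fintype ι]

theorem equivMvPolynomial_ι (α : Module.Dual K V) :
    SymmetricAlgebra.equivMvPolynomial b (SymmetricAlgebra.ι K _ α) = linForm (b.repr α) := by
  conv_lhs => rw [← b.sum_repr α]
  simp only [map_sum, map_smul, SymmetricAlgebra.equivMvPolynomial_ι_apply, smul_eq_C_mul, linForm]

theorem map_derivation_ι (α : Module.Dual K V)
    (θ : Derivation K (SymmetricAlgebra K (Module.Dual K V))
      (SymmetricAlgebra K (Module.Dual K V))) :
    SymmetricAlgebra.equivMvPolynomial b (θ (SymmetricAlgebra.ι K _ α)) =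
      ∑ i, C (b.repr α i) *
        SymmetricAlgebra.equivMvPolynomial b (θ (SymmetricAlgebra.ι K _ (b i))) := by
  conv_lhs => rw [← b.sum_repr α]
  simp only [map_sum, map_smul, Derivation.map_smul, smul_eq_C_mul]

/-- One form per hyperplane suffices: forms with the same kernel differ by a unit scalar. -/
theorem mem_logDerivations_iff {A : CentralArrangement K V} {m : A.Multiplicity}
    {α : A.hyperplanes → Module.Dual K V} (hα : ∀ H, LinearMap.ker (α H) = H.1)
    (θ : Derivation K (SymmetricAlgebra K (Module.Dual K V))
      (SymmetricAlgebra K (Module.Dual K V))) :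
    θ ∈ A.logDerivations m ↔
      (fun i => SymmetricAlgebra.equivMvPolynomial b (θ (SymmetricAlgebra.ι K _ (b i)))) ∈
        logVectors (fun H i => b.repr (α H) i) fun H => (m H : ℕ) := by
  have hdvd : ∀ (β : Module.Dual K V) (n : ℕ),
      θ (SymmetricAlgebra.ι K _ β) ∈ Ideal.span {SymmetricAlgebra.ι K (Module.Dual K V) β ^ n} ↔
      linForm (b.repr β) ^ n ∣ ∑ i, C (b.repr β i) *
        SymmetricAlgebra.equivMvPolynomial b (θ (SymmetricAlgebra.ι K _ (b i))) := by
    intro β n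
    rw [Ideal.mem_span_singleton, ← map_derivation_ι, ← equivMvPolynomial_ι,
      ← map_pow (SymmetricAlgebra.equivMvPolynomial b), map_dvd_iff]
  constructor
  · intro h H
    exact (hdvd _ _).1 (h H (α H) (hα H))
  · intro h H β hβ
    obtain ⟨c, rfl⟩ := exists_eq_smul_of_ker_eq ((hα H).trans hβ.symm)
    have hc : c ≠ 0 := by
      rintro rfl
      rw [zero_smul] at hβ
      exact ne_zero_of_ker_mem (A := A) (hβ ▸ H.2) rfl
    have h1 := (hdvd _ _).2 (h H)
    rw [Ideal.mem_span_singleton] at h1 ⊢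
    have hu : IsUnit (algebraMap K (SymmetricAlgebra K (Module.Dual K V)) c) :=
      (isUnit_iff_ne_zero.2 hc).map _
    rw [map_smul, Derivation.map_smul, Algebra.smul_def, Algebra.smul_def, mul_pow]
    rw [(hu.pow _).mul_left_dvd, hu.dvd_mul_left]
    exact h1

theorem derivation_ext_basis {θ₁ θ₂ : Derivation K (SymmetricAlgebra K (Module.Dual K V))
      (SymmetricAlgebra K (Module.Dual K V))}
    (h : ∀ i, θ₁ (SymmetricAlgebra.ι K _ (b i)) = θ₂ (SymmetricAlgebra.ι K _ (b i))) :
    θ₁ = θ₂ := by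
  have hι : ∀ α, θ₁ (SymmetricAlgebra.ι K _ α) = θ₂ (SymmetricAlgebra.ι K _ α) := by
    intro α
    rw [← b.sum_repr α]
    simp only [map_sum, map_smul, Derivation.map_smul, h]
  ext x
  induction x using SymmetricAlgebra.induction with
  | algebraMap r => simp
  | ι x => exact hι x
  | mul x y hx hy => simp [Derivation.leibniz, hx, hy]
  | add x y hx hy => simp [hx, hy]

/-- Freeness of a multiplicity, expressed in coordinates. -/
theorem isFreeMultiplicity_iff {A : CentralArrangement K V} {m : A.Multiplicity}
    {α : A.hyperplanes → Module.Dual K V} (hα : ∀ H, LinearMap.ker (α H) = H.1) :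
    A.IsFreeMultiplicity m ↔ Module.Free (MvPolynomial ι K)
      (logVectors (fun H i => b.repr (α H) i) fun H => (m H : ℕ)) := by
  let e := SymmetricAlgebra.equivMvPolynomial b
  let _ := RingHomInvPair.of_ringEquiv e.toRingEquiv
  let _ := RingHomInvPair.of_ringEquiv_symm e.toRingEquiv
  let φ : A.logDerivations m →ₛₗ[(e.toRingEquiv :
      SymmetricAlgebra K (Module.Dual K V) →+* MvPolynomial ι K)]
      logVectors (fun H i => b.repr (α H) i) fun H => (m H : ℕ) :=
    { toFun := fun θ => ⟨fun i => e (θ.1 (SymmetricAlgebra.ι K _ (b i))),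
        (mem_logDerivations_iff b hα θ.1).1 θ.2⟩
      map_add' := fun θ₁ θ₂ => by
        apply Subtype.ext
        ext1 i
        simp
      map_smul' := fun c θ => by
        apply Subtype.ext
        ext1 i
        simp }
  have hφ : Function.Bijective φ := by
    constructor
    · intro θ₁ θ₂ h
      apply Subtype.ext
      refine derivation_ext_basis b fun i => e.injective ?_
      exact congrFun (congrArg Subtype.val h) i
    · rintro ⟨f, hf⟩
      obtain ⟨θ, hθ⟩ := exists_derivation b f
      refine ⟨⟨θ, (mem_logDerivations_iff b hα θ).2 ?_⟩, ?_⟩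
      · rwa [funext hθ]
      · exact Subtype.ext (funext hθ)
  exact Module.Free.iff_of_equiv (LinearEquiv.ofBijective φ hφ)

end Coordinates

/-! ### Freeness in dimensions one and two. -/

section SmallDimension

variable {K J : Type*} [Field K]

theorem exists_det_one_mulVec_eq_zero {R : Type*} [EuclideanDomain R] (g : Fin 2 → R) :
    ∃ U : Matrix (Fin 2) (Fin 2) R, U.det = 1 ∧ U 1 0 * g 0 + U 1 1 * g 1 = 0 := by
  classical
  by_cases h : EuclideanDomain.gcd (g 0) (g 1) = 0
  · obtain ⟨h0, h1⟩ := EuclideanDomain.gcd_eq_zero_iff.1 h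
    exact ⟨1, by simp, by simp [h0, h1]⟩
  · obtain ⟨p, hp⟩ := EuclideanDomain.gcd_dvd_left (g 0) (g 1)
    obtain ⟨q, hq⟩ := EuclideanDomain.gcd_dvd_right (g 0) (g 1)
    have hb := EuclideanDomain.gcd_eq_gcd_ab (g 0) (g 1)
    set x := EuclideanDomain.gcdA (g 0) (g 1)
    set y := EuclideanDomain.gcdB (g 0) (g 1)
    set d := EuclideanDomain.gcd (g 0) (g 1)
    refine ⟨!![x, y; -q, p], ?_, ?_⟩
    · rw [Matrix.det_fin_two_of]
      apply mul_left_cancel₀ h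
      rw [mul_one]
      conv_rhs => rw [hb, hp, hq]
      ring
    · simp only [Matrix.of_apply, Matrix.cons_val_zero, Matrix.cons_val_one]
      rw [hp, hq]
      ring

/-- The restriction of polynomials in two variables to a line through the origin, and a section of
this map. -/
theorem exists_restriction_to_line {a : Fin 2 → K} (ha : a ≠ 0) :
    ∃ (ψ : MvPolynomial (Fin 2) K →ₐ[K] Polynomial K)
      (s : Polynomial K →ₐ[K] MvPolynomial (Fin 2) K),
      (∀ p, ψ (s p) = p) ∧ ∀ f, ψ f = 0 → linForm a ∣ f := by
  -- The line is spanned by `(-a 1, a 0)`; the form with coefficients `w₀, w₁` takes the value `1`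
  -- there and defines the section.
  obtain ⟨w₀, w₁, hw⟩ : ∃ w₀ w₁ : K, w₁ * a 0 - w₀ * a 1 = 1 := by
    by_cases h0 : a 0 = 0
    · have h1 : a 1 ≠ 0 := fun h1 => ha (funext fun i => by fin_cases i <;> simp [h0, h1])
      exact ⟨-(a 1)⁻¹, 0, by simp [h1]⟩
    · exact ⟨0, (a 0)⁻¹, by simp [h0]⟩
  let ψ : MvPolynomial (Fin 2) K →ₐ[K] Polynomial K :=
    aeval ![Polynomial.C (-(a 1)) * Polynomial.X, Polynomial.C (a 0) * Polynomial.X]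
  let s : Polynomial K →ₐ[K] MvPolynomial (Fin 2) K :=
    Polynomial.aeval (C w₀ * X 0 + C w₁ * X 1)
  have hlin : linForm a = C (a 0) * X 0 + C (a 1) * X 1 := by
    rw [linForm, Fin.sum_univ_two]
  have hψC : ∀ c, ψ (C c) = Polynomial.C c := fun c => ψ.commutes c
  have hsC : ∀ c, s (Polynomial.C c) = C c := fun c => s.commutes c
  have hψ0 : ψ (X 0) = Polynomial.C (-(a 1)) * Polynomial.X := by simp [ψ]
  have hψ1 : ψ (X 1) = Polynomial.C (a 0) * Polynomial.X := by simp [ψ]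
  have hsX : s Polynomial.X = C w₀ * X 0 + C w₁ * X 1 := by simp [s]
  have hwP : C w₁ * C (a 0) - C w₀ * C (a 1) = (1 : MvPolynomial (Fin 2) K) := by
    rw [← C_mul, ← C_mul, ← C_sub, hw, C_1]
  refine ⟨ψ, s, fun p => ?_, fun f hf => ?_⟩
  · have : ψ.comp s = AlgHom.id K _ := by
      apply Polynomial.algHom_ext
      rw [AlgHom.comp_apply, hsX, map_add, map_mul, map_mul, hψ0, hψ1, hψC, hψC, AlgHom.id_apply,
        ← mul_assoc, ← mul_assoc, ← add_mul, ← Polynomial.C_mul, ← Polynomial.C_mul,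
        ← Polynomial.C_add]
      rw [show w₀ * -a 1 + w₁ * a 0 = 1 by rw [← hw]; ring, Polynomial.C_1, one_mul]
    exact DFunLike.congr_fun this p
  · have h1 : (Ideal.Quotient.mkₐ K (Ideal.span {linForm a})) =
        (Ideal.Quotient.mkₐ K (Ideal.span {linForm a})).comp (s.comp ψ) := by
      refine MvPolynomial.algHom_ext fun i => ?_
      simp only [AlgHom.comp_apply, Ideal.Quotient.mkₐ_eq_mk]
      rw [Ideal.Quotient.mk_eq_mk_iff_sub_mem, Ideal.mem_span_singleton, hlin]
      fin_cases i
      · refine ⟨C w₁, ?_⟩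
        simp only [Fin.zero_eta, Fin.isValue]
        rw [hψ0, map_mul, hsC, hsX, C_neg]
        linear_combination (-(X 0 : MvPolynomial (Fin 2) K)) * hwP
      · refine ⟨-C w₀, ?_⟩
        simp only [Fin.mk_one, Fin.isValue]
        rw [hψ1, map_mul, hsC, hsX]
        linear_combination (-(X 1 : MvPolynomial (Fin 2) K)) * hwP
    have h2 := DFunLike.congr_fun h1 f
    simp only [AlgHom.comp_apply, hf, map_zero] at h2
    rwa [Ideal.Quotient.mkₐ_eq_mk, Ideal.Quotient.eq_zero_iff_mem,
      Ideal.mem_span_singleton] at h2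

/-- Write the value of row `i` on the `j`-th form as its `m j`-th power times `g i`. On the line
where the form vanishes, the `g i` lie in the principal ideal domain `K[X]`, so a lifted matrix of
determinant one makes the second of them vanish there. That row gains a factor for free; the other
row is multiplied by the form. -/
theorem exists_det_eq_add_single [DecidableEq J] {a : J → Fin 2 → K} {m : J → ℕ} {j : J}
    (ha : a j ≠ 0) {θ : Matrix (Fin 2) (Fin 2) (MvPolynomial (Fin 2) K)}
    (hθ : ∀ i, θ i ∈ logVectors a m) :
    ∃ θ' : Matrix (Fin 2) (Fin 2) (MvPolynomial (Fin 2) K),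
      (∀ i, θ' i ∈ logVectors a (m + Pi.single j 1)) ∧ θ'.det = linForm (a j) * θ.det := by
  obtain ⟨ψ, s, hψs, hψ⟩ := exists_restriction_to_line ha
  choose g hg using fun i => hθ i j
  obtain ⟨U, hU, hUg⟩ := exists_det_one_mulVec_eq_zero fun i => ψ (g i)
  let M : Matrix (Fin 2) (Fin 2) (MvPolynomial (Fin 2) K) := U.map s * θ
  have hMrow : ∀ i, M i = s (U i 0) • θ 0 + s (U i 1) • θ 1 := by
    intro i
    ext1 k
    simp [M, Matrix.mul_apply, Fin.sum_univ_two]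
  have hM : ∀ i, M i ∈ logVectors a m := by
    intro i
    rw [hMrow]
    exact Submodule.add_mem _ (Submodule.smul_mem _ _ (hθ 0)) (Submodule.smul_mem _ _ (hθ 1))
  have hMdet : M.det = θ.det := by
    have : (U.map s).det = 1 := by
      rw [← AlgHom.mapMatrix_apply, ← AlgHom.map_det, hU, map_one]
    rw [Matrix.det_mul, this, one_mul]
  have hstep : ∀ f : Fin 2 → MvPolynomial (Fin 2) K, f ∈ logVectors a m →
      linForm (a j) ^ (m j + 1) ∣ ∑ i, C (a j i) * f i →
      f ∈ logVectors a (m + Pi.single j 1) := by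
    intro f hf hfj j'
    by_cases h : j' = j
    · subst h
      simpa using hfj
    · simpa [h] using hf j'
  refine ⟨M.updateRow 0 (linForm (a j) • M 0), fun i => ?_, ?_⟩
  · fin_cases i
    · simp only [Fin.zero_eta, Matrix.updateRow_self]
      refine hstep _ (Submodule.smul_mem _ _ (hM 0)) ?_
      have : ∑ i, C (a j i) * (linForm (a j) • M 0) i =
          (∑ i, C (a j i) * M 0 i) * linForm (a j) := by
        rw [Finset.sum_mul]
        exact Finset.sum_congr rfl fun i _ => by simp only [Pi.smul_apply, smul_eq_mul]; ring
      rw [this, pow_succ]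
      exact mul_dvd_mul (hM 0 j) dvd_rfl
    · simp only [Fin.mk_one]
      rw [Matrix.updateRow_ne one_ne_zero]
      refine hstep _ (hM 1) ?_
      have h1 : ∑ i, C (a j i) * M 1 i =
          linForm (a j) ^ m j * (s (U 1 0) * g 0 + s (U 1 1) * g 1) := by
        have h0 := hg 0
        have h1 := hg 1
        rw [Fin.sum_univ_two] at h0 h1 ⊢
        rw [hMrow]
        simp only [Pi.add_apply, Pi.smul_apply, smul_eq_mul]
        linear_combination s (U 1 0) * h0 + s (U 1 1) * h1
      rw [h1, pow_succ]
      refine mul_dvd_mul dvd_rfl (hψ _ ?_)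
      rw [map_add, map_mul, map_mul, hψs, hψs]
      exact hUg
  · rw [Matrix.det_updateRow_smul, Matrix.updateRow_eq_self, hMdet]

variable [Fintype J]

theorem definingPoly_add_single [DecidableEq J] {ι : Type*} [Fintype ι] (a : J → ι → K)
    (m : J → ℕ) (j : J) :
    definingPoly a (m + Pi.single j 1) = linForm (a j) * definingPoly a m := by
  simp only [definingPoly, Pi.add_apply, pow_add, Finset.prod_mul_distrib]
  rw [mul_comm]
  congr 1
  rw [Finset.prod_eq_single j]
  · simp
  · intro i _ hi
    simp [hi]
  · simp

/-- Induction on the total multiplicity, starting with the identity matrix; allowing the value zero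
in `m` makes this start possible. -/
theorem exists_det_eq_definingPoly_two {a : J → Fin 2 → K} (ha : ∀ j, a j ≠ 0) (m : J → ℕ) :
    ∃ θ : Matrix (Fin 2) (Fin 2) (MvPolynomial (Fin 2) K),
      (∀ i, θ i ∈ logVectors a m) ∧ θ.det = definingPoly a m := by
  classical
  induction hn : ∑ j, m j generalizing m with
  | zero =>
    have hm : ∀ j, m j = 0 := by simpa using hn
    exact ⟨1, fun i j => by simp [hm j], by simp [definingPoly, hm]⟩
  | succ n ih =>
    obtain ⟨j, hj⟩ : ∃ j, m j ≠ 0 := by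
      by_contra! h
      simp [h] at hn
    let m' : J → ℕ := m - Pi.single j 1
    have hm' : m = m' + Pi.single j 1 := by
      ext k
      by_cases hk : k = j
      · subst hk
        simp [m']
        omega
      · simp [m', hk]
    obtain ⟨θ, hθ, hdet⟩ := ih m' (by
      rw [hm'] at hn
      simp only [Pi.add_apply, Finset.sum_add_distrib, Finset.sum_pi_single', Finset.mem_univ,
        if_true] at hn
      omega)
    obtain ⟨θ', hθ', hdet'⟩ := exists_det_eq_add_single (ha j) hθ
    rw [hm']
    exact ⟨θ', hθ', by rw [hdet', hdet, definingPoly_add_single]⟩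

theorem exists_det_eq_definingPoly {d : ℕ} (hd : d = 1 ∨ d = 2) {a : J → Fin d → K}
    (ha : ∀ j, a j ≠ 0) (m : J → ℕ) :
    ∃ θ : Matrix (Fin d) (Fin d) (MvPolynomial (Fin d) K),
      (∀ i, θ i ∈ logVectors a m) ∧ θ.det = definingPoly a m := by
  rcases hd with rfl | rfl
  · refine ⟨definingPoly a m • 1, fun i => smul_mem_logVectors_of_dvd dvd_rfl _, by simp⟩
  · exact exists_det_eq_definingPoly_two ha m

end SmallDimension

/-! ### Block diagonal bases for products. -/

section Blocks

variable {K J Q : Type*} [Field K] [Fintype J] [Fintype Q] {d : Q → ℕ}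

theorem sum_sigma_eq_of_support {M : Type*} [AddCommMonoid M] {q : Q} {f : (Σ q, Fin (d q)) → M}
    (h : ∀ x, x.1 ≠ q → f x = 0) : ∑ x, f x = ∑ k, f ⟨q, k⟩ := by
  classical
  rw [Fintype.sum_sigma, Finset.sum_eq_single q]
  · intro q' _ hq'
    exact Finset.sum_eq_zero fun k _ => h _ hq'
  · simp

theorem rename_linForm {a : (Σ q, Fin (d q)) → K} {q : Q} (h : ∀ x, x.1 ≠ q → a x = 0) :
    rename (Sigma.mk q) (linForm fun k => a ⟨q, k⟩) = linForm a := by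
  rw [linForm, linForm, sum_sigma_eq_of_support (q := q) fun x hx => by simp [h x hx]]
  simp

variable [LinearOrder Q]

theorem det_blockDiagonal_sigma {R : Type*} [CommRing R]
    (M : ∀ q, Matrix (Fin (d q)) (Fin (d q)) R) :
    (Matrix.blockDiagonal' M).det = ∏ q, (M q).det := by
  rw [(Matrix.blockTriangular_blockDiagonal' M).det_fintype]
  refine Finset.prod_congr rfl fun q _ => ?_
  let e : Fin (d q) ≃ {x : Σ q, Fin (d q) // x.1 = q} :=
    { toFun := fun k => ⟨⟨q, k⟩, rfl⟩
      invFun := fun x => x.2 ▸ x.1.2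
      left_inv := fun k => rfl
      right_inv := by
        rintro ⟨⟨q', k⟩, rfl⟩
        rfl }
  rw [← Matrix.det_submatrix_equiv_self e]
  congr 1
  ext i k
  simp [e, Matrix.toSquareBlock_def, Matrix.blockDiagonal'_apply_eq]

/-- If every linear form involves only the variables of one block, and all blocks have size one or
two, then every multiplicity is free. -/
theorem free_logVectors_of_blocks (hd : ∀ q, d q = 1 ∨ d q = 2)
    {a : J → (Σ q, Fin (d q)) → K} (ha : IsReducedFamily a) {q : J → Q}
    (hq : ∀ j x, x.1 ≠ q j → a j x = 0) (m : J → ℕ) :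
    Module.Free (MvPolynomial (Σ q, Fin (d q)) K) (logVectors a m) := by
  have hblock : ∀ p : Q, ∃ θ : Matrix (Fin (d p)) (Fin (d p)) (MvPolynomial (Fin (d p)) K),
      (∀ i, θ i ∈ logVectors (fun (j : {j // q j = p}) k => a j ⟨p, k⟩) fun j => m j) ∧
      θ.det = definingPoly (fun (j : {j // q j = p}) k => a j ⟨p, k⟩) fun j => m j := by
    intro p
    refine exists_det_eq_definingPoly (hd p) (fun j h => ha.ne_zero j.1 (funext fun x => ?_)) _
    obtain ⟨p', k⟩ := x
    by_cases hp : p' = p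
    · subst hp
      exact congrFun h k
    · exact hq _ _ (by rw [j.2]; exact hp)
  choose θ hθ hdet using hblock
  let Θ := Matrix.blockDiagonal' fun p =>
    (θ p).map (rename (Sigma.mk p) : _ → MvPolynomial (Σ q, Fin (d q)) K)
  refine free_logVectors_of_det (θ := Θ) ha (fun x j => ?_) ?_
  · obtain ⟨p, i⟩ := x
    rw [sum_sigma_eq_of_support (q := q j) fun x hx => by simp [hq j x hx]]
    by_cases hp : q j = p
    · subst hp
      have h1 := map_dvd (rename (R := K) (Sigma.mk (β := fun q => Fin (d q)) (q j)))
        (hθ (q j) i ⟨j, rfl⟩)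
      rw [map_pow, map_sum, rename_linForm (hq j)] at h1
      simpa [Θ, Matrix.blockDiagonal'_apply_eq] using h1
    · rw [Finset.sum_eq_zero]
      · exact dvd_zero _
      · intro k _
        simp only [Θ]
        rw [Matrix.blockDiagonal'_apply_ne _ _ _ (Ne.symm hp), mul_zero]
  · have h1 : Θ.det = definingPoly a m := by
      rw [det_blockDiagonal_sigma]
      have h2 : ∀ p, ((θ p).map
          (rename (Sigma.mk p) : _ → MvPolynomial (Σ q, Fin (d q)) K)).det =
          ∏ j : {j // q j = p}, linForm (a j) ^ m j := by
        intro p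
        rw [← AlgHom.mapMatrix_apply, ← AlgHom.map_det, hdet, definingPoly, map_prod]
        refine Finset.prod_congr rfl fun j _ => ?_
        rw [map_pow, rename_linForm fun x hx => hq j x (by rw [j.2]; exact hx)]
      simp only [h2]
      exact Fintype.prod_fiberwise q fun j => linForm (a j) ^ m j
    rw [h1]

end Blocks

/-! ### Product decompositions: subarrangements and total freeness. -/

section Products

variable {K V : Type*} [Field K] [AddCommGroup V] [Module K V]

/-- An arrangement all of whose hyperplanes are pulled back from factors of dimension one or two
is a product of arrangements in these factors. -/
theorem isProductOfDimOneOrTwo_of_forall_comap {A : CentralArrangement K V} {s : ℕ}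
    {d : Fin s → ℕ} (e : V ≃ₗ[K] (∀ i, Fin (d i) → K)) (hd : ∀ i, d i = 1 ∨ d i = 2)
    (h : ∀ H ∈ A.hyperplanes, ∃ (i : Fin s) (H' : Submodule K (Fin (d i) → K)),
      H = (H'.comap (LinearMap.proj i : (∀ j, Fin (d j) → K) →ₗ[K] _)).comap (e : V →ₗ[K] _)) :
    A.IsProductOfDimOneOrTwo := by
  let f : ∀ i, V →ₗ[K] (Fin (d i) → K) := fun i => LinearMap.proj i ∘ₗ
    (e : V →ₗ[K] ∀ j, Fin (d j) → K)
  have hf : ∀ i, Function.Surjective (f i) := fun i =>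
    (LinearMap.proj_surjective (R := K) i).comp e.surjective
  -- The factor consists of all hyperplanes whose pullback lies in `A`, so one inclusion is
  -- automatic.
  let B : ∀ i, CentralArrangement K (Fin (d i) → K) := fun i =>
    { hyperplanes := (fun H => H.comap (f i)) ⁻¹' A.hyperplanes
      finite := A.finite.preimage (Submodule.comap_injective_of_surjective (hf i)).injOn
      codim_one := fun H hH => by
        rw [← finrank_quotient_comap (f i) (hf i) H]
        exact A.codim_one _ hH }
  refine ⟨s, d, B, e, hd, CentralArrangement.ext (Set.Subset.antisymm ?_ ?_)⟩
  · intro H hH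
    obtain ⟨i, H', rfl⟩ := h H hH
    exact ⟨_, Set.mem_iUnion.2 ⟨i, H', hH, rfl⟩, rfl⟩
  · rintro _ ⟨_, hX, rfl⟩
    obtain ⟨i, H', hH', rfl⟩ := Set.mem_iUnion.1 hX
    exact hH'

theorem IsProductOfDimOneOrTwo.of_isSubarrangement {A B : CentralArrangement K V}
    (hA : A.IsProductOfDimOneOrTwo) (hB : B.IsSubarrangement A) : B.IsProductOfDimOneOrTwo := by
  obtain ⟨s, d, C, e, hd, rfl⟩ := hA
  refine isProductOfDimOneOrTwo_of_forall_comap e hd fun H hH => ?_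
  obtain ⟨_, hX, rfl⟩ := hB hH
  obtain ⟨i, H', -, rfl⟩ := Set.mem_iUnion.1 hX
  exact ⟨i, H', rfl⟩

theorem IsProductOfDimOneOrTwo.isTotallyFree {A : CentralArrangement K V}
    (hA : A.IsProductOfDimOneOrTwo) : A.IsTotallyFree := by
  classical
  obtain ⟨s, d, B, e, hd, rfl⟩ := hA
  intro m
  let c : Module.Basis (Σ i, Fin (d i)) K V :=
    Module.Basis.ofEquivFun (e.trans (LinearEquiv.piCurry K fun i (_ : Fin (d i)) => K).symm)
  have hc : ∀ (x : Σ i, Fin (d i)) (i : Fin s), x.1 ≠ i → e (c x) i = 0 := by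
    intro x i hx
    ext k
    have h1 := c.equivFun_self x ⟨i, k⟩
    rw [if_neg fun h => hx (congrArg Sigma.fst h)] at h1
    rw [Module.Basis.equivFun_ofEquivFun] at h1
    exact h1
  have hform : ∀ H : ((prod B).comapEquiv e).hyperplanes, ∃ (i : Fin s) (α : Module.Dual K V),
      LinearMap.ker α = H.1 ∧ ∀ x : Σ i, Fin (d i), x.1 ≠ i → α (c x) = 0 := by
    rintro ⟨_, _, hX, rfl⟩
    obtain ⟨i, H', hH', rfl⟩ := Set.mem_iUnion.1 hX
    obtain ⟨β, rfl⟩ := (B i).exists_ker_eq hH'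
    refine ⟨i, β ∘ₗ LinearMap.proj i ∘ₗ
    (e : V →ₗ[K] ∀ j, Fin (d j) → K), rfl, fun x hx => ?_⟩
    change β (e (c x) i) = 0
    rw [hc x i hx, map_zero]
  choose q α hα hq using hform
  let _ : Fintype ((prod B).comapEquiv e).hyperplanes := ((prod B).comapEquiv e).finite.fintype
  rw [isFreeMultiplicity_iff c.dualBasis hα]
  refine free_logVectors_of_blocks hd (isReducedFamily_repr _ hα) (q := q) (fun H x hx => ?_) _
  rw [Module.Basis.dualBasis_repr]
  exact hq H x hx

end Products

/-! ### Non-free multiplicities and subarrangements from a long circuit. -/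

section Circuits

variable {K V : Type*} [Field K] [AddCommGroup V] [Module K V]

/-- `T` is the support of a linear form `h` with respect to a basis `b`, the kernels of `h` and of
`b i` for `i ∈ T` belong to the arrangement, and `T` has at least three elements: together these
hyperplanes form a circuit of length at least four. -/
structure IsLongCircuit {ι : Type*} (A : CentralArrangement K V)
    (b : Module.Basis ι K (Module.Dual K V)) (h : Module.Dual K V) (T : Finset ι) : Prop where
  mem_iff : ∀ i, i ∈ T ↔ b.repr h i ≠ 0
  ker_mem : LinearMap.ker h ∈ A.hyperplanes
  ker_basis_mem : ∀ i ∈ T, LinearMap.ker (b i) ∈ A.hyperplanes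
  three_le_card : 3 ≤ T.card

variable {ι : Type*} {A : CentralArrangement K V} {b : Module.Basis ι K (Module.Dual K V)}
  {h : Module.Dual K V} {T : Finset ι}

theorem IsLongCircuit.ker_ne (hC : IsLongCircuit A b h T) (i : ι) :
    LinearMap.ker (b i) ≠ LinearMap.ker h := by
  classical
  intro hk
  obtain ⟨c, rfl⟩ := exists_eq_smul_of_ker_eq hk
  obtain ⟨j, hj, hji⟩ := Finset.exists_mem_ne (one_lt_two.trans hC.three_le_card) i
  apply (hC.mem_iff j).1 hj
  simp [hji.symm]

theorem ker_basis_injective : Function.Injective fun i => LinearMap.ker (b i) := by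
  intro i j hk
  by_contra hij
  obtain ⟨c, hc⟩ := exists_eq_smul_of_ker_eq hk
  have := congrArg (fun x => b.repr x j) hc
  simp [hij] at this

/-- Linear forms for the hyperplanes can be chosen compatibly with a circuit. -/
theorem IsLongCircuit.exists_forms (hC : IsLongCircuit A b h T) :
    ∃ α : A.hyperplanes → Module.Dual K V, (∀ H, LinearMap.ker (α H) = H.1) ∧
      α ⟨_, hC.ker_mem⟩ = h ∧ ∀ i (hi : i ∈ T), α ⟨_, hC.ker_basis_mem i hi⟩ = b i := by
  classical
  have hex : ∀ H : A.hyperplanes, ∃ α : Module.Dual K V, LinearMap.ker α = H.1 ∧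
      (H.1 = LinearMap.ker h → α = h) ∧ ∀ i, H.1 = LinearMap.ker (b i) → α = b i := by
    intro H
    by_cases h1 : H.1 = LinearMap.ker h
    · exact ⟨h, h1.symm, fun _ => rfl, fun i hi => absurd (hi.symm.trans h1) (hC.ker_ne i)⟩
    · by_cases h2 : ∃ i, H.1 = LinearMap.ker (b i)
      · obtain ⟨i, hi⟩ := h2
        refine ⟨b i, hi.symm, fun h' => absurd h' h1, fun j hj => ?_⟩
        rw [ker_basis_injective (b := b) (hi.symm.trans hj)]
      · obtain ⟨α, hα⟩ := A.exists_ker_eq H.2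
        exact ⟨α, hα, fun h' => absurd h' h1, fun i hi => absurd ⟨i, hi⟩ h2⟩
  choose α hα h1 h2 using hex
  exact ⟨α, hα, h1 _ rfl, fun i _ => h2 _ i rfl⟩

variable [Fintype ι]

theorem IsLongCircuit.not_free [DecidableEq ι] (hC : IsLongCircuit A b h T)
    (hA : ∀ H ∈ A.hyperplanes, H = LinearMap.ker h ∨ ∃ i ∈ T, H = LinearMap.ker (b i)) :
    ¬ A.IsFree := by
  classical
  obtain ⟨α, hα, hαh, hαb⟩ := hC.exists_forms
  let _ : Fintype A.hyperplanes := A.finite.fintype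
  rw [IsFree, isFreeMultiplicity_iff b hα]
  refine not_free_logVectors_of_circuit (isReducedFamily_repr b hα) (h := ⟨_, hC.ker_mem⟩)
    -- The value outside `T` is arbitrary: only indices in the support of `h` matter.
    (e := fun i => if hi : i ∈ T then ⟨_, hC.ker_basis_mem i hi⟩ else ⟨_, hC.ker_mem⟩)
    (T := T) (fun i hi => ?_) (fun i => ?_) hC.three_le_card ?_
  · rw [hαh, ← hC.mem_iff] at hi
    rw [dif_pos hi, hαb i hi]
    ext j
    rw [Module.Basis.repr_self, Finsupp.single_eq_pi_single]
  · rw [hαh, hC.mem_iff]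
  · have hsub : A.hyperplanes ⊆
        ((insert (LinearMap.ker h) (T.image fun i => LinearMap.ker (b i)) : Finset _) :
          Set (Submodule K V)) := by
      intro H hH
      rcases hA H hH with rfl | ⟨i, hi, rfl⟩
      · simp
      · simpa using Or.inr ⟨i, hi, rfl⟩
    rw [← Nat.card_eq_fintype_card, Nat.card_coe_set_eq]
    refine (Set.ncard_le_ncard hsub (Finset.finite_toSet _)).trans ?_
    rw [Set.ncard_coe_finset]
    exact (Finset.card_insert_le _ _).trans (Nat.add_le_add_right Finset.card_image_le 1)

/-- The subarrangement of the hyperplanes of a circuit. -/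
def IsLongCircuit.arrangement (hC : IsLongCircuit A b h T) : CentralArrangement K V where
  hyperplanes := {H | H = LinearMap.ker h ∨ ∃ i ∈ T, H = LinearMap.ker (b i)}
  finite := A.finite.subset (by
    rintro _ (rfl | ⟨i, hi, rfl⟩)
    exacts [hC.ker_mem, hC.ker_basis_mem i hi])
  codim_one := by
    rintro _ (rfl | ⟨i, hi, rfl⟩)
    exacts [A.codim_one _ hC.ker_mem, A.codim_one _ (hC.ker_basis_mem i hi)]

theorem IsLongCircuit.exists_not_isFree [DecidableEq ι] (hC : IsLongCircuit A b h T) :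
    ∃ B : CentralArrangement K V, B.IsSubarrangement A ∧ ¬ B.IsFree := by
  refine ⟨hC.arrangement, ?_, ?_⟩
  · rintro _ (rfl | ⟨i, hi, rfl⟩)
    exacts [hC.ker_mem, hC.ker_basis_mem i hi]
  · have hC' : IsLongCircuit hC.arrangement b h T :=
      ⟨hC.mem_iff, Or.inl rfl, fun i hi => Or.inr ⟨i, hi, rfl⟩, hC.three_le_card⟩
    exact hC'.not_free fun H hH => hH

theorem IsLongCircuit.infinite_NFM [DecidableEq ι] (hC : IsLongCircuit A b h T) :
    A.NFM.Infinite := by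
  classical
  obtain ⟨α, hα, hαh, hαb⟩ := hC.exists_forms
  let _ : Fintype A.hyperplanes := A.finite.fintype
  let h' : A.hyperplanes := ⟨_, hC.ker_mem⟩
  let e : ι → A.hyperplanes := fun i =>
    if hi : i ∈ T then ⟨_, hC.ker_basis_mem i hi⟩ else h'
  have he : ∀ i (hi : i ∈ T), e i = ⟨_, hC.ker_basis_mem i hi⟩ := fun i hi => dif_pos hi
  have heinj : Set.InjOn e T := by
    intro i hi j hj hij
    rw [he i hi, he j hj] at hij
    exact ker_basis_injective (congrArg Subtype.val hij)
  obtain ⟨i₀, hi₀, i₁, hi₁, i₂, hi₂, h01, h02, h12⟩ := Finset.two_lt_card.1 hC.three_le_card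
  -- Larger than the number of hyperplanes, so the multiplicities `1` outside the coordinate part of
  -- the circuit add up to less than `n t`.
  let n : ℕ → ℕ+ := fun t => ⟨t + Fintype.card A.hyperplanes + 1, Nat.succ_pos _⟩
  let m : ℕ → A.Multiplicity := fun t H =>
    if H = e i₀ then n t else if H = e i₁ then 2 * n t else
      if H ∈ T.image e then 3 * n t else 1
  have hm₀ : ∀ t, m t (e i₀) = n t := fun t => if_pos rfl
  have hm₁ : ∀ t, m t (e i₁) = 2 * n t := fun t =>
    (if_neg fun h => h01 (heinj hi₀ hi₁ h.symm)).trans (if_pos rfl)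
  have hm₂ : ∀ t, ∀ c ∈ T, c ≠ i₀ → c ≠ i₁ → m t (e c) = 3 * n t := fun t c hc h0 h1 => by
    simp only [m]
    rw [if_neg fun h => h0 (heinj hc hi₀ h), if_neg fun h => h1 (heinj hc hi₁ h),
      if_pos (Finset.mem_image_of_mem e hc)]
  have hm₃ : ∀ t, ∀ H ∉ T.image e, m t H = 1 := fun t H hH => by
    simp only [m]
    rw [if_neg, if_neg, if_neg hH]
    · rintro rfl; exact hH (Finset.mem_image_of_mem e hi₁)
    · rintro rfl; exact hH (Finset.mem_image_of_mem e hi₀)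
  have hh : h' ∉ T.image e := by
    rw [Finset.mem_image]
    rintro ⟨i, hi, hie⟩
    rw [he i hi] at hie
    exact hC.ker_ne i (congrArg Subtype.val hie)
  refine Set.infinite_of_injective_forall_mem (f := m) (fun t t' htt => ?_) fun t => ?_
  · have h1 := congrFun htt (e i₀)
    rw [hm₀, hm₀] at h1
    have h2 := congrArg PNat.val h1
    simpa [n] using h2
  · have ha : ∀ i, i ∈ T ↔ b.repr (α h') i ≠ 0 := fun i => by rw [hαh, hC.mem_iff]
    change ¬ A.IsFreeMultiplicity _
    rw [isFreeMultiplicity_iff b hα]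
    refine not_free_logVectors_of_spread (isReducedFamily_repr b hα) (h := h') (e := e)
      (t := n t) (T := T) (fun i hi => ?_) h01 h02 h12 ((ha _).1 hi₀) ((ha _).1 hi₁)
      ((ha _).1 hi₂) (by rw [hm₀]) (by rw [hm₁]; rfl)
      (fun c hc h0 h1 => by rw [hm₂ t c ((ha c).2 hc) h0 h1]; rfl) (by rw [hm₃ t h' hh]; rfl)
      ha ?_
    · have hi' := (ha i).2 hi
      rw [he i hi', hαb i hi']
      ext j
      rw [Module.Basis.repr_self, Finsupp.single_eq_pi_single]
    · rw [← Finset.sum_image (f := fun H => (m t H : ℕ)) heinj,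
        ← Finset.sum_add_sum_compl (T.image e)]
      refine Nat.add_lt_add_left ?_ _
      rw [Finset.sum_congr rfl fun H hH => by rw [hm₃ t H (Finset.mem_compl.1 hH)]]
      simp only [PNat.one_coe, Finset.sum_const, smul_eq_mul, mul_one]
      refine (Finset.card_le_univ _).trans_lt ?_
      change _ < t + Fintype.card A.hyperplanes + 1
      omega

end Circuits

/-! ### Arrangements without long circuits are products. -/

section Decomposition

variable {K V : Type*} [Field K] [AddCommGroup V] [Module K V]

/-- There is a basis of the dual space such that every linear form of the arrangement is a
combination of basis vectors that belong to the arrangement. -/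
theorem exists_adapted_basis [FiniteDimensional K V] (A : CentralArrangement K V) :
    ∃ (n : ℕ) (b : Module.Basis (Fin n) K (Module.Dual K V)),
      ∀ α, LinearMap.ker α ∈ A.hyperplanes →
        ∀ i, b.repr α i ≠ 0 → LinearMap.ker (b i) ∈ A.hyperplanes := by
  -- A maximal independent set `s` of forms of `A` spans all of them, so the vectors added to
  -- complete the basis never occur in their expansions.
  obtain ⟨s, hs, -, hspan, hli⟩ := exists_linearIndepOn_id_extension
    (linearIndependent_empty K (Module.Dual K V))
    (Set.empty_subset {α : Module.Dual K V | LinearMap.ker α ∈ A.hyperplanes})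
  let b := Module.Basis.extend hli
  have hfin : Finite (hli.extend (Set.subset_univ s)) := Module.Finite.finite_basis b
  let e := Finite.equivFin (hli.extend (Set.subset_univ s))
  refine ⟨_, b.reindex e, fun α hα i hi => ?_⟩
  have h1 : α ∈ Submodule.span K (b '' {x | x.1 ∈ s}) := by
    refine Submodule.span_mono ?_ (hspan hα)
    intro x hx
    exact ⟨⟨x, Module.Basis.subset_extend hli hx⟩, hx, Module.Basis.extend_apply_self hli _⟩
  rw [Module.Basis.mem_span_image] at h1
  rw [Module.Basis.repr_reindex_apply] at hi
  have h2 : (e.symm i).1 ∈ s := h1 (Finsupp.mem_support_iff.2 hi)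
  rw [Module.Basis.reindex_apply, Module.Basis.extend_apply_self]
  exact hs h2

/-- Replacing a basis vector `b j` by a vector `α` whose `j`-th coordinate is nonzero. -/
theorem exists_basis_replace {ι M : Type*} [Fintype ι] [DecidableEq ι] [AddCommGroup M]
    [Module K M] (b : Module.Basis ι K M) {α : M} {j : ι} (hj : b.repr α j ≠ 0) :
    ∃ b' : Module.Basis ι K M, b' j = α ∧ (∀ i, i ≠ j → b' i = b i) ∧
      ∀ β, b'.repr β j = b.repr β j / b.repr α j ∧
        ∀ i, i ≠ j → b'.repr β i = b.repr β i - b.repr β j / b.repr α j * b.repr α i := by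
  have hcomb : ∀ g : ι → K, ∑ i, g i • Function.update b j α i =
      ∑ i, g i • b i + g j • (α - b j) := by
    intro g
    have : ∀ i, g i • Function.update b j α i =
        g i • b i + if i = j then g j • (α - b j) else 0 := by
      intro i
      split_ifs with h
      · subst h
        rw [Function.update_self, smul_sub, add_sub_cancel]
      · rw [Function.update_of_ne h, add_zero]
    simp [this, Finset.sum_add_distrib]
  have hexp : ∀ β : M, ∑ i, (if i = j then b.repr β j / b.repr α j else
      b.repr β i - b.repr β j / b.repr α j * b.repr α i) • Function.update b j α i = β := by
    intro β
    apply b.repr.injective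
    ext k
    rw [hcomb]
    simp only [map_add, map_sum, map_smul, map_sub, Module.Basis.repr_self, Finsupp.add_apply,
      Finsupp.smul_apply, Finsupp.sub_apply, Finsupp.finsetSum_apply, Finsupp.single_apply,
      smul_eq_mul, mul_ite, mul_one, mul_zero, Finset.sum_ite_eq', Finset.mem_univ, if_true]
    by_cases hk : k = j
    · subst hk
      simp only [if_true]
      field_simp
      ring
    · simp only [if_neg hk, if_neg (Ne.symm hk)]
      ring
  have hli : LinearIndependent K (Function.update b j α) := by
    rw [Fintype.linearIndependent_iff]
    intro g hg
    rw [hcomb] at hg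
    have hcoord : ∀ k, g k + g j * (b.repr α k - if k = j then 1 else 0) = 0 := by
      intro k
      have := congrArg (fun x => b.repr x k) hg
      simpa [Finsupp.single_apply, eq_comm] using this
    have hgj : g j = 0 := by
      have := hcoord j
      rw [if_pos rfl] at this
      have h2 : g j * b.repr α j = 0 := by linear_combination this
      exact (mul_eq_zero.1 h2).resolve_right hj
    intro k
    simpa [hgj] using hcoord k
  let b' := Module.Basis.mk hli (fun β _ => hexp β ▸ Submodule.sum_mem _ fun i _ =>
    Submodule.smul_mem _ _ (Submodule.subset_span ⟨i, rfl⟩))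
  have hb' : ⇑b' = Function.update b j α := Module.Basis.coe_mk _ _
  have hrepr : ∀ β i, b'.repr β i = if i = j then b.repr β j / b.repr α j else
      b.repr β i - b.repr β j / b.repr α j * b.repr α i := by
    intro β i
    have h1 := hexp β
    rw [← hb'] at h1
    conv_lhs => rw [← h1, Module.Basis.repr_sum_self]
  refine ⟨b', by rw [hb', Function.update_self], fun i hi => by rw [hb', Function.update_of_ne hi],
    fun β => ⟨by rw [hrepr, if_pos rfl], fun i hi => by rw [hrepr, if_neg hi]⟩⟩

/-- Three distinct basis vectors that are linked by two linear forms of the arrangement lead to a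
circuit of length at least four. -/
theorem exists_isLongCircuit_of_linked {ι : Type*} [Fintype ι] {A : CentralArrangement K V}
    {b : Module.Basis ι K (Module.Dual K V)}
    (hb : ∀ α, LinearMap.ker α ∈ A.hyperplanes →
      ∀ i, b.repr α i ≠ 0 → LinearMap.ker (b i) ∈ A.hyperplanes)
    {α β : Module.Dual K V} (hα : LinearMap.ker α ∈ A.hyperplanes)
    (hβ : LinearMap.ker β ∈ A.hyperplanes) {i j k : ι} (hij : i ≠ j) (hjk : j ≠ k) (hik : i ≠ k)
    (hαi : b.repr α i ≠ 0) (hαj : b.repr α j ≠ 0) (hβj : b.repr β j ≠ 0)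
    (hβk : b.repr β k ≠ 0) :
    ∃ (b' : Module.Basis ι K (Module.Dual K V)) (h : Module.Dual K V) (T : Finset ι),
      IsLongCircuit A b' h T := by
  classical
  have hcard : ∀ T : Finset ι, i ∈ T → j ∈ T → k ∈ T → 3 ≤ T.card := fun T h1 h2 h3 =>
    Finset.two_lt_card.2 ⟨i, h1, j, h2, k, h3, hij, hik, hjk⟩
  have hdirect : ∀ γ : Module.Dual K V, LinearMap.ker γ ∈ A.hyperplanes → b.repr γ i ≠ 0 →
      b.repr γ j ≠ 0 → b.repr γ k ≠ 0 → ∃ (b' : Module.Basis ι K (Module.Dual K V))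
        (h : Module.Dual K V) (T : Finset ι), IsLongCircuit A b' h T := fun γ hγ h1 h2 h3 =>
    ⟨b, γ, Finset.univ.filter fun l => b.repr γ l ≠ 0, by simp, hγ,
      fun l hl => hb γ hγ l (by simpa using hl),
      hcard _ (by simpa using h1) (by simpa using h2) (by simpa using h3)⟩
  by_cases hαk : b.repr α k = 0
  swap
  · exact hdirect α hα hαi hαj hαk
  by_cases hβi : b.repr β i = 0
  swap
  · exact hdirect β hβ hβi hβj hβk
  -- Now `α` misses `k` and `β` misses `i`. Exchanging `b j` for `α` gives `β` nonzero coordinates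
  -- at `i`, `j` and `k`. Its other new coordinates are nonzero only where `α` or `β` already was,
  -- so the basis vectors involved still belong to `A`.
  obtain ⟨b', hb'j, hb'i, hrepr⟩ := exists_basis_replace b hαj
  refine ⟨b', β, Finset.univ.filter fun l => b'.repr β l ≠ 0, by simp, hβ, fun l hl => ?_,
    hcard _ ?_ ?_ ?_⟩
  · replace hl : b'.repr β l ≠ 0 := by simpa using hl
    by_cases hlj : l = j
    · rw [hlj, hb'j]
      exact hα
    · rw [hb'i l hlj]
      rw [(hrepr β).2 l hlj] at hl
      by_cases hβl : b.repr β l = 0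
      · refine hb α hα l fun h0 => hl ?_
        rw [hβl, h0, mul_zero, sub_zero]
      · exact hb β hβ l hβl
  · rw [Finset.mem_filter, (hrepr β).2 i hij, hβi, zero_sub, neg_ne_zero]
    exact ⟨Finset.mem_univ _, mul_ne_zero (div_ne_zero hβj hαj) hαi⟩
  · rw [Finset.mem_filter, (hrepr β).1]
    exact ⟨Finset.mem_univ _, div_ne_zero hβj hαj⟩
  · rw [Finset.mem_filter, (hrepr β).2 k hjk.symm, hαk, mul_zero, sub_zero]
    exact ⟨Finset.mem_univ _, hβk⟩

/-- Coordinates on `V` given by a basis of the dual space. -/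
theorem exists_equivFun_of_dual_basis [FiniteDimensional K V] {ι : Type*} [Finite ι]
    (b : Module.Basis ι K (Module.Dual K V)) :
    ∃ e : V ≃ₗ[K] (ι → K), ∀ v i, e v i = b i v := by
  classical
  let e := (Module.evalEquiv K V).trans b.dualBasis.equivFun
  refine ⟨e, fun v i => ?_⟩
  simp [e, Module.Basis.dualBasis_equivFun]

theorem isProductOfDimOneOrTwo_of_blocks [FiniteDimensional K V] {A : CentralArrangement K V}
    {s : ℕ} {d : Fin s → ℕ} (hd : ∀ q, d q = 1 ∨ d q = 2)
    (b : Module.Basis (Σ q, Fin (d q)) K (Module.Dual K V))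
    (h : ∀ α, LinearMap.ker α ∈ A.hyperplanes →
      ∃ q, ∀ x : Σ q, Fin (d q), x.1 ≠ q → b.repr α x = 0) :
    A.IsProductOfDimOneOrTwo := by
  obtain ⟨e, he⟩ := exists_equivFun_of_dual_basis b
  refine isProductOfDimOneOrTwo_of_forall_comap
    (e.trans (LinearEquiv.piCurry K fun i (_ : Fin (d i)) => K)) hd fun H hH => ?_
  obtain ⟨α, rfl⟩ := A.exists_ker_eq hH
  obtain ⟨q, hq⟩ := h α hH
  refine ⟨q, LinearMap.ker (∑ k, b.repr α ⟨q, k⟩ • (LinearMap.proj k : (Fin (d q) → K) →ₗ[K] K)),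
    ?_⟩
  ext v
  have h1 : α v = ∑ k, b.repr α ⟨q, k⟩ * e v ⟨q, k⟩ := by
    conv_lhs => rw [← b.sum_repr α]
    rw [sum_sigma_eq_of_support (q := q) fun x hx => by rw [hq x hx, zero_smul]]
    simp [he]
  simp only [LinearMap.mem_ker, Submodule.mem_comap, h1]
  simp [Sigma.curry]

/-- Without long circuits, linking is transitive for a trivial reason: a chain of two proper links
must return to its start. The classes thus have one or two elements and serve as blocks; a basis
vector that occurs in no form is a class by itself and gives an empty factor. -/
theorem exists_isLongCircuit_of_not_product [FiniteDimensional K V] {A : CentralArrangement K V}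
    (hA : ¬ A.IsProductOfDimOneOrTwo) :
    ∃ (n : ℕ) (b : Module.Basis (Fin n) K (Module.Dual K V)) (h : Module.Dual K V)
      (T : Finset (Fin n)), IsLongCircuit A b h T := by
  classical
  by_contra hno
  apply hA
  obtain ⟨n, b, hb⟩ := A.exists_adapted_basis
  let r : Fin n → Fin n → Prop := fun i j =>
    i = j ∨ ∃ α, LinearMap.ker α ∈ A.hyperplanes ∧ b.repr α i ≠ 0 ∧ b.repr α j ≠ 0
  have hlinked : ∀ i j k, r i j → r j k → i ≠ j → j ≠ k → i = k := by
    intro i j k h1 h2 hij hjk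
    by_contra hik
    obtain ⟨α, hα, hαi, hαj⟩ := h1.resolve_left hij
    obtain ⟨β, hβ, hβj, hβk⟩ := h2.resolve_left hjk
    obtain ⟨b', h, T, hT⟩ :=
      exists_isLongCircuit_of_linked hb hα hβ hij hjk hik hαi hαj hβj hβk
    exact hno ⟨n, b', h, T, hT⟩
  have hsymm : ∀ i j, r i j → r j i := by
    rintro i j (rfl | ⟨α, hα, h1, h2⟩)
    exacts [Or.inl rfl, Or.inr ⟨α, hα, h2, h1⟩]
  let S : Setoid (Fin n) :=
    { r := r
      iseqv := ⟨fun i => Or.inl rfl, fun h => hsymm _ _ h, fun {i j k} h1 h2 => by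
        by_cases hij : i = j
        · rwa [hij]
        · by_cases hjk : j = k
          · rwa [← hjk]
          · exact Or.inl (hlinked i j k h1 h2 hij hjk)⟩ }
  let eQ := Finite.equivFin (Quotient S)
  let q : Fin n → Fin (Nat.card (Quotient S)) := fun i => eQ (Quotient.mk S i)
  have hq : ∀ i j, q i = q j ↔ r i j := fun i j =>
    eQ.injective.eq_iff.trans Quotient.eq
  let d : Fin (Nat.card (Quotient S)) → ℕ := fun p => Fintype.card {i // q i = p}
  have hd : ∀ p, d p = 1 ∨ d p = 2 := by
    intro p
    have h1 : 0 < d p := by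
      obtain ⟨i, hi⟩ := Quotient.exists_rep (eQ.symm p)
      exact Fintype.card_pos_iff.2 ⟨⟨i, by simp only [q]; rw [hi, Equiv.apply_symm_apply]⟩⟩
    have h2 : d p ≤ 2 := by
      by_contra! h3
      obtain ⟨i, j, k, hij, hik, hjk⟩ := Fintype.two_lt_card_iff.1 h3
      refine hik (Subtype.ext (hlinked i j k ((hq _ _).1 (i.2.trans j.2.symm))
        ((hq _ _).1 (j.2.trans k.2.symm)) ?_ ?_))
      exacts [fun h => hij (Subtype.ext h), fun h => hjk (Subtype.ext h)]
    omega
  let e : Fin n ≃ Σ p, Fin (d p) :=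
    (Equiv.sigmaFiberEquiv q).symm.trans (Equiv.sigmaCongrRight fun p => Fintype.equivFin _)
  have he : ∀ x, q (e.symm x) = x.1 := by
    rintro ⟨p, k⟩
    exact ((Fintype.equivFin {i // q i = p}).symm k).2
  refine isProductOfDimOneOrTwo_of_blocks hd (b.reindex e) fun α hα => ?_
  obtain ⟨i, hi⟩ : ∃ i, b.repr α i ≠ 0 := by
    by_contra! h0
    exact ne_zero_of_ker_mem hα (b.repr.map_eq_zero_iff.1 (Finsupp.ext h0))
  refine ⟨q i, fun x hx => ?_⟩
  rw [Module.Basis.repr_reindex_apply]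
  by_contra hne
  apply hx
  rw [← he x, hq]
  exact Or.inr ⟨α, hα, hne, hi⟩

end Decomposition

end CentralArrangement

theorem mainTheorem1 {K V : Type*} [Field K] [AddCommGroup V] [Module K V]
    [FiniteDimensional K V] (A : CentralArrangement K V) :
    List.TFAE [
      A.IsTotallyFree,
      A.NFM.Finite,
      A.IsProductOfDimOneOrTwo,
      ∀ B : CentralArrangement K V, B.IsSubarrangement A → B.IsFree] := by
  tfae_have 1 → 2 := fun h => by
    have : A.NFM = ∅ := Set.eq_empty_of_forall_notMem fun m hm => hm (h m)
    rw [this]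
    exact Set.finite_empty
  tfae_have 2 → 3 := fun h => by
    by_contra h3
    obtain ⟨n, b, γ, T, hC⟩ := CentralArrangement.exists_isLongCircuit_of_not_product h3
    exact hC.infinite_NFM h
  tfae_have 3 → 1 := fun h => h.isTotallyFree
  tfae_have 3 → 4 := fun h B hB => (h.of_isSubarrangement hB).isTotallyFree _
  tfae_have 4 → 3 := fun h => by
    by_contra h3
    obtain ⟨n, b, γ, T, hC⟩ := CentralArrangement.exists_isLongCircuit_of_not_product h3
    obtain ⟨B, hB, hfree⟩ := hC.exists_not_isFree
    exact hfree (h B hB)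
  tfae_finish
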